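/- **Setting.** Let $T>0$ and let $(\alpha_t,\beta_t)_{0\le t<T}$ be a noise schedule: $\alpha$ and $\beta^2$ are continuously differentiable on $[0,T)$, $\alpha_t>0$ on $[0,T)$, $\beta_t>0$ on $(0,T)$, $\alpha_0=1$, $\beta_0=0$. Put $$b(t)=\frac{d\log\alpha_t}{dt},\qquad \sigma^2(t)=\frac{d\beta_t^2}{dt}-2\,\frac{d\log\alpha_t}{dt}\,\beta_t^2 ,$$ where $\sigma$ is a real continuous function on $[0,T)$ (in particular, the right-hand side is assumed to be nonnegative). Write $\phi(\cdot;m,C)$ for the density of $\mathcal N(m,C)$. Let $\Sigma\in\mathbb R^{d\times d}$ and $\Sigma_{\rm obs}\in\mathbb R^{r\times r}$ be symmetric positive definite, $\mu_1,\dots,\mu_K\in\mathbb R^d$, $\pi_k\ge 0$ with $\sum_k\pi_k=1$, and let $\mathcal M:\mathbb R^d\to\mathbb R^r$ be differentiable. On a probability space let * $\xi$ be a random index and $Z_0$ a random vector with $P(\xi=k)=\pi_k$ and, given $\xi=k$, $Z_0\sim\mathcal N(\mu_k,\Sigma)$; so $Z_0$ has density $\sum_k\pi_k\,\phi(\cdot;\mu_k,\Sigma)$;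 * $Z$ be a solution on $[0,T)$, with continuous paths, of the forward SDE $dZ_t=b(t)Z_t\,dt+\sigma(t)\,dW_t$ started from $Z_0$, where $W$ is a standard $d$-dimensional Brownian motion; * $Y=\mathcal M(Z_0)+\varepsilon$ with $\varepsilon\sim\mathcal N(0,\Sigma_{\rm obs})$, where $\varepsilon$ is independent of $(\xi,Z_0)$ and $W$ is independent of $(\xi,Z_0,\varepsilon)$. Let $p(y\mid x)=\phi(y;\mathcal M(x),\Sigma_{\rm obs})$ be the likelihood, and for $t\in(0,T)$ put $\Sigma_t=\alpha_t^2\Sigma+\beta_t^2I$. **Theorem (the exact posterior score).** Let $t\in(0,T)$. Then $(\xi,Z_0,Z_t,Y)$ has the joint density $$f(k,z_0,z,y)=\pi_k\,\phi(z_0;\mu_k,\Sigma)\,\phi(z;\alpha_tz_0,\beta_t^2I)\,p(y\mid z_0)$$ with respect to counting measure in $k$ and Lebesgue measure in the other variables. All conditional densities, probabilities and expectations below are the ones obtained from $f$ by integrating out variables and forming quotients. The posterior density $p_{Z_t|Y}(\cdot\mid y)$ is everywhere positive, and, for all $z\in\mathbb R^d$, $y\in\mathbb R^r$ for which the conditional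 expectation below exists, $z_t\mapsto\log p_{Z_t|Y}(z_t\mid y)$ is differentiable at $z$ and $$\nabla_{z_t}\log p_{Z_t|Y}(z_t\mid y)\Big|_{z_t=z}=\sum_{k=1}^K p(\xi=k\mid Z_t=z,Y=y)\,\bigl(-\Sigma_t^{-1}(z-\alpha_t\mu_k)\bigr)+J(t)\,\mathbb E\bigl[\nabla_x\log p(y\mid x)\big|_{x=Z_0}\,\big|\,Z_t=z,\,Y=y\bigr],$$ where $$J(t)=\alpha_t\,\Sigma\,\bigl(\alpha_t^2\Sigma+\beta_t^2I\bigr)^{-1}.$$ For every $k$ with $\pi_k>0$, $J(t)$ is the Jacobian at every point $z$ of the mean $z\mapsto\mathbb E[Z_0\mid Z_t=z,\xi=k]$ of the reverse-time transition kernel. (If $\pi_k=0$, the same holds for the mean of the probability density proportional to $z_0\mapsto\phi(z_0;\mu_k,\Sigma)\,\phi(z;\alpha_tz_0,\beta_t^2I)$.) -/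

import Mathlib

open MeasureTheory ProbabilityTheory Filter Set
open scoped NNReal ENNReal

namespace PosteriorScore

/-! ### Gaussian densities -/

/-- The action of a square matrix on Euclidean space. -/
noncomputable abbrev act {d : ℕ} (A : Matrix (Fin d) (Fin d) ℝ) :
    EuclideanSpace ℝ (Fin d) →L[ℝ] EuclideanSpace ℝ (Fin d) :=
  Matrix.toEuclideanCLM (n := Fin d) (𝕜 := ℝ) A

/-- The density `φ(x; m, S)` of the Gaussian distribution `N(m, S)` on `ℝᵈ`
(for a positive definite covariance matrix `S`). -/
noncomputable def gaussDensity {d : ℕ} (m : EuclideanSpace ℝ (Fin d))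
    (S : Matrix (Fin d) (Fin d) ℝ) (x : EuclideanSpace ℝ (Fin d)) : ℝ :=
  (Real.sqrt ((2 * Real.pi) ^ d * S.det))⁻¹ *
    Real.exp (-(1 / 2) * inner ℝ (x - m) (act S⁻¹ (x - m)))

/-! ### The forward linear SDE -/

/-- `W` is a standard Brownian motion in `ℝᵈ`: its coordinates are independent standard real
Brownian motions. -/
structure IsStdBrownian {Ω : Type*} [MeasurableSpace Ω] {d : ℕ}
    (W : ℝ≥0 → Ω → EuclideanSpace ℝ (Fin d)) (P : Measure Ω) : Prop where
  coord : ∀ i, IsBrownianReal (fun t ω => W t ω i) P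
  indep : iIndepFun (fun (i : Fin d) (ω : Ω) (t : ℝ≥0) => W t ω i) P

/-- `I` is the stochastic integral `∫₀ᵗ σ(s) dW_s` of a deterministic continuous integrand `σ`:
the limit in probability of the left-endpoint Riemann sums along the uniform partitions of
`[0, t]`. -/
def IsWienerIntegral {Ω : Type*} [MeasurableSpace Ω] {d : ℕ} (P : Measure Ω)
    (W : ℝ≥0 → Ω → EuclideanSpace ℝ (Fin d)) (σ : ℝ → ℝ) (t : ℝ≥0)
    (I : Ω → EuclideanSpace ℝ (Fin d)) : Prop :=
  TendstoInMeasure P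
    (fun (n : ℕ) (ω : Ω) => ∑ i ∈ Finset.range n,
      σ ((i : ℝ) * t / n) •
        (W (((i : ℝ≥0) + 1) * t / n) ω - W ((i : ℝ≥0) * t / n) ω))
    atTop I

/-- `Z` is a solution on `[0, T)` of the linear SDE `dZ_t = b(t) Z_t dt + σ(t) dW_t`:
it has almost surely continuous paths and, for each `t < T`,
`Z_t = Z_0 + ∫₀ᵗ b(s) Z_s ds + ∫₀ᵗ σ(s) dW_s` almost surely. -/
structure SolvesLinearSDE {Ω : Type*} [MeasurableSpace Ω] {d : ℕ} (P : Measure Ω)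
    (T : ℝ) (b σ : ℝ → ℝ) (W Z : ℝ≥0 → Ω → EuclideanSpace ℝ (Fin d)) : Prop where
  aemeasurable : ∀ t : ℝ≥0, (t : ℝ) < T → AEMeasurable (Z t) P
  continuous_paths : ∀ᵐ ω ∂P, ContinuousOn (fun t : ℝ≥0 => Z t ω) {t | (t : ℝ) < T}
  integral_eq : ∀ t : ℝ≥0, (t : ℝ) < T →
    IsWienerIntegral P W σ t
      (fun ω => Z t ω - Z 0 ω - ∫ s in (0 : ℝ)..(t : ℝ), b s • Z s.toNNReal ω)

/-- A noise schedule `(α_t, β_t)` on `[0, T)`, starting from the undiffused state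
`α_0 = 1`, `β_0 = 0`. -/
structure IsNoiseSchedule (T : ℝ) (α β : ℝ → ℝ) : Prop where
  T_pos : 0 < T
  alpha_zero : α 0 = 1
  beta_zero : β 0 = 0
  alpha_pos : ∀ t ∈ Ico 0 T, 0 < α t
  beta_pos : ∀ t ∈ Ioo 0 T, 0 < β t
  alpha_contDiff : ContDiffOn ℝ 1 α (Ico 0 T)
  beta_sq_contDiff : ContDiffOn ℝ 1 (fun t => β t ^ 2) (Ico 0 T)

/-- The drift coefficient `b(t) = d log α_t / dt` (a one-sided derivative at `t = 0`). -/
noncomputable def drift (T : ℝ) (α : ℝ → ℝ) (t : ℝ) : ℝ :=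
  derivWithin (fun s => Real.log (α s)) (Ico 0 T) t

/-- The squared diffusion coefficient `σ²(t) = dβ_t²/dt - 2 (d log α_t/dt) β_t²`
(with one-sided derivatives at `t = 0`). -/
noncomputable def diffusionSq (T : ℝ) (α β : ℝ → ℝ) (t : ℝ) : ℝ :=
  derivWithin (fun s => β s ^ 2) (Ico 0 T) t - 2 * drift T α t * β t ^ 2

/-! ### Likelihood, transition density and joint density

Below, `a` and `c` stand for the values `α_t` and `β_t` of the schedule at a fixed time `t`. -/

/-- The likelihood `p_{Y|X}(y|x)` for `Y = M(X) + ε`, `ε ∼ N(0, Sobs)`. -/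
noncomputable def likelihood {d r : ℕ}
    (M : EuclideanSpace ℝ (Fin d) → EuclideanSpace ℝ (Fin r)) (Sobs : Matrix (Fin r) (Fin r) ℝ)
    (y : EuclideanSpace ℝ (Fin r)) (x : EuclideanSpace ℝ (Fin d)) : ℝ :=
  gaussDensity (M x) Sobs y

/-- The likelihood score `S_{Y|X}(y|x) = ∇ₓ log p_{Y|X}(y|x)`. -/
noncomputable def likelihoodScore {d r : ℕ}
    (M : EuclideanSpace ℝ (Fin d) → EuclideanSpace ℝ (Fin r)) (Sobs : Matrix (Fin r) (Fin r) ℝ)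
    (y : EuclideanSpace ℝ (Fin r)) (x : EuclideanSpace ℝ (Fin d)) : EuclideanSpace ℝ (Fin d) :=
  gradient (fun x' => Real.log (likelihood M Sobs y x')) x

/-- The joint density of `(Z_0, Z_t)` given `ξ = k`, where `m = μ_k`. -/
noncomputable def componentDensity {d : ℕ} (S : Matrix (Fin d) (Fin d) ℝ) (a c : ℝ)
    (m z₀ z : EuclideanSpace ℝ (Fin d)) : ℝ :=
  gaussDensity m S z₀ * gaussDensity (a • z₀) (c ^ 2 • (1 : Matrix (Fin d) (Fin d) ℝ)) z

/-- The continuous version of the joint density of `(ξ, Z_0, Z_t, Y)`, with respect to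
counting measure in `k` and Lebesgue measure in the other variables. -/
noncomputable def jointDensity {d r K : ℕ} (w : Fin K → ℝ)
    (μ : Fin K → EuclideanSpace ℝ (Fin d)) (S : Matrix (Fin d) (Fin d) ℝ) (a c : ℝ)
    (M : EuclideanSpace ℝ (Fin d) → EuclideanSpace ℝ (Fin r)) (Sobs : Matrix (Fin r) (Fin r) ℝ)
    (k : Fin K) (z₀ z : EuclideanSpace ℝ (Fin d)) (y : EuclideanSpace ℝ (Fin r)) : ℝ :=
  w k * componentDensity S a c (μ k) z₀ z * likelihood M Sobs y z₀

/-! ### Marginal and conditional densities obtained from a joint density `f` of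
`(ξ, Z_0, Z_t, Y)` -/

/-- The density `p_{Z_t,Y}(z, y)`. -/
noncomputable def densityZtY {d r K : ℕ}
    (f : Fin K → EuclideanSpace ℝ (Fin d) → EuclideanSpace ℝ (Fin d) →
      EuclideanSpace ℝ (Fin r) → ℝ)
    (z : EuclideanSpace ℝ (Fin d)) (y : EuclideanSpace ℝ (Fin r)) : ℝ :=
  ∑ k, ∫ z₀, f k z₀ z y

/-- The density `p_Y(y)`. -/
noncomputable def densityY {d r K : ℕ}
    (f : Fin K → EuclideanSpace ℝ (Fin d) → EuclideanSpace ℝ (Fin d) →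
      EuclideanSpace ℝ (Fin r) → ℝ)
    (y : EuclideanSpace ℝ (Fin r)) : ℝ :=
  ∫ z, densityZtY f z y

/-- The conditional density `p_{Z_t|Y}(z|y)`. -/
noncomputable def condDensityZt {d r K : ℕ}
    (f : Fin K → EuclideanSpace ℝ (Fin d) → EuclideanSpace ℝ (Fin d) →
      EuclideanSpace ℝ (Fin r) → ℝ)
    (z : EuclideanSpace ℝ (Fin d)) (y : EuclideanSpace ℝ (Fin r)) : ℝ :=
  densityZtY f z y / densityY f y

/-- The posterior mixture weight `p_{ξ|Z_t,Y}(k|z, y)`. -/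
noncomputable def posteriorWeight {d r K : ℕ}
    (f : Fin K → EuclideanSpace ℝ (Fin d) → EuclideanSpace ℝ (Fin d) →
      EuclideanSpace ℝ (Fin r) → ℝ)
    (k : Fin K) (z : EuclideanSpace ℝ (Fin d)) (y : EuclideanSpace ℝ (Fin r)) : ℝ :=
  (∫ z₀, f k z₀ z y) / densityZtY f z y

/-- The conditional density `p_{Z_0|Z_t,Y}(z₀|z, y)`. -/
noncomputable def condDensityZ0 {d r K : ℕ}
    (f : Fin K → EuclideanSpace ℝ (Fin d) → EuclideanSpace ℝ (Fin d) →
      EuclideanSpace ℝ (Fin r) → ℝ)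
    (z₀ z : EuclideanSpace ℝ (Fin d)) (y : EuclideanSpace ℝ (Fin r)) : ℝ :=
  (∑ k, f k z₀ z y) / densityZtY f z y

/-- The conditional expectation `E[g(Z_0) | Z_t = z, Y = y]`. -/
noncomputable def condExpectation {d r K : ℕ}
    (f : Fin K → EuclideanSpace ℝ (Fin d) → EuclideanSpace ℝ (Fin d) →
      EuclideanSpace ℝ (Fin r) → ℝ)
    (g : EuclideanSpace ℝ (Fin d) → EuclideanSpace ℝ (Fin d))
    (z : EuclideanSpace ℝ (Fin d)) (y : EuclideanSpace ℝ (Fin r)) : EuclideanSpace ℝ (Fin d) :=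
  ∫ z₀, condDensityZ0 f z₀ z y • g z₀

/-! ### The objects in the posterior score formula -/

/-- The covariance `Σ_t = α_t² Σ + β_t² I`. -/
noncomputable def covT {d : ℕ} (S : Matrix (Fin d) (Fin d) ℝ) (a c : ℝ) :
    Matrix (Fin d) (Fin d) ℝ :=
  a ^ 2 • S + c ^ 2 • (1 : Matrix (Fin d) (Fin d) ℝ)

/-- The component score `S_{Z_t|k}(z) = -Σ_t⁻¹ (z - α_t μ_k)`, where `m = μ_k`. -/
noncomputable def componentScore {d : ℕ} (S : Matrix (Fin d) (Fin d) ℝ) (a c : ℝ)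
    (m z : EuclideanSpace ℝ (Fin d)) : EuclideanSpace ℝ (Fin d) :=
  -act (covT S a c)⁻¹ (z - a • m)

/-- The matrix `J(t) = α_t Σ (α_t² Σ + β_t² I)⁻¹`. -/
noncomputable def jacobianJ {d : ℕ} (S : Matrix (Fin d) (Fin d) ℝ) (a c : ℝ) :
    Matrix (Fin d) (Fin d) ℝ :=
  a • (S * (covT S a c)⁻¹)

/-- The mean of the reverse-time transition kernel `p_{Z_0|Z_t,ξ}(·|z, k)`, where `m = μ_k`. -/
noncomputable def reverseMean {d : ℕ} (S : Matrix (Fin d) (Fin d) ℝ) (a c : ℝ)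
    (m z : EuclideanSpace ℝ (Fin d)) : EuclideanSpace ℝ (Fin d) :=
  (∫ z₀, componentDensity S a c m z₀ z)⁻¹ • ∫ z₀, componentDensity S a c m z₀ z • z₀

end PosteriorScore

/-! The proof has two independent halves: the law of `(ξ, Z_0, Z_t, Y)`, and a calculus argument on
its density.

Law. Put `I_s = Z_s - Z_0 - ∫₀ˢ b Z`, the Wiener integral of `σ` over `[0, s]`. Path by path,
variation of constants gives `Z_t - α_t Z_0 = I_t + ∫₀ᵗ α_t (b/α)(s) I_s ds`, so no stochastic
calculus is needed: Riemann sums of the time integral are finite combinations of Wiener integrals.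
Their integrands converge boundedly on `[0, t)` to `σ(u) (1 + α_t (1/α_u - 1/α_t)) = σ(u) α_t/α_u`,
because `(1/α)' = -b/α`. The variance of the limit is `∫₀ᵗ (σ α_t/α_u)² du = β_t²`, because
`(β²/α²)' = σ²/α²`. Characteristic functions restricted to events of `η = ((ξ, Z_0), ε)` pass to
limits in probability, which yields Gaussianity and independence from `η` together
(`SolvesLinearSDE.isIndepGaussian`). A measure-preserving shear then produces the joint density
(`hasLaw_jointDensity`).

Score. Let `q_k(z₀, z)` be the density of `(Z_0, Z_t)` given `k`, let `s_k(z)` be the component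
score and `p` the likelihood. The algebraic core is `act_jacobianJ_score`, which says `∇_z q_k = s_k
q_k - J ∇_{z₀} q_k`. Multiplying by `p`, integrating in `z₀` and integrating by parts moves the
gradient onto `p`, and `∇p = p ∇log p`. As all components share `Σ`, the matrix `J` does not depend
on `k` and leaves the mixture sum. Dividing by the density gives the formula
(`hasGradientAt_densityZtY`, `hasGradientAt_log_condDensityZt`).

With `p = 1` the same integration by parts gives Tweedie's formula for the reverse mean, which is
affine in `z` with linear part `J` (`reverseMean_eq`). -/

namespace PosteriorScore

/-! ### Nondegenerate Gaussian measures and their densities -/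

section GaussianDensity

variable {d : ℕ}

lemma gaussDensity_pos (m : EuclideanSpace ℝ (Fin d)) {S : Matrix (Fin d) (Fin d) ℝ}
    (hS : S.PosDef) (x : EuclideanSpace ℝ (Fin d)) : 0 < gaussDensity m S x := by
  have := hS.det_pos
  unfold gaussDensity
  positivity

lemma continuous_gaussDensity (m : EuclideanSpace ℝ (Fin d)) (S : Matrix (Fin d) (Fin d) ℝ) :
    Continuous (gaussDensity m S) := by
  unfold gaussDensity
  fun_prop

lemma act_act (A B : Matrix (Fin d) (Fin d) ℝ) (x : EuclideanSpace ℝ (Fin d)) :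
    act A (act B x) = act (A * B) x := by
  rw [act, act, act, map_mul]
  rfl

lemma act_one (x : EuclideanSpace ℝ (Fin d)) : act 1 x = x := by
  rw [act, map_one]
  rfl

lemma det_act (A : Matrix (Fin d) (Fin d) ℝ) :
    LinearMap.det (act A : EuclideanSpace ℝ (Fin d) →ₗ[ℝ] EuclideanSpace ℝ (Fin d)) = A.det := by
  rw [act, Matrix.coe_toEuclideanCLM_eq_toEuclideanLin]
  exact LinearMap.det_toLpLin 2 A

lemma inner_act_left {A : Matrix (Fin d) (Fin d) ℝ} (hA : A.IsHermitian)
    (x y : EuclideanSpace ℝ (Fin d)) : inner ℝ (act A x) y = inner ℝ x (act A y) := by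
  have h : IsSelfAdjoint (act A) := IsSelfAdjoint.map hA _
  rw [← ContinuousLinearMap.adjoint_inner_right, h.adjoint_eq]

lemma inner_act_nonneg {S : Matrix (Fin d) (Fin d) ℝ} (hS : S.PosSemidef)
    (x : EuclideanSpace ℝ (Fin d)) : 0 ≤ inner ℝ x (act S x) := by
  rw [Matrix.inner_toEuclideanCLM]
  simpa using hS.dotProduct_mulVec_nonneg x.ofLp

lemma gaussDensity_le (m : EuclideanSpace ℝ (Fin d)) {S : Matrix (Fin d) (Fin d) ℝ}
    (hS : S.PosDef) (x : EuclideanSpace ℝ (Fin d)) :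
    gaussDensity m S x ≤ (Real.sqrt ((2 * Real.pi) ^ d * S.det))⁻¹ := by
  unfold gaussDensity
  refine mul_le_of_le_one_right (by positivity) (Real.exp_le_one_iff.2 ?_)
  have := inner_act_nonneg hS.inv.posSemidef (x - m)
  linarith

/-- The density of the standard Gaussian measure. -/
lemma stdGaussian_eq_withDensity :
    stdGaussian (EuclideanSpace ℝ (Fin d)) = volume.withDensity
      (fun x ↦ ENNReal.ofReal ((Real.sqrt ((2 * Real.pi) ^ d))⁻¹ *
        Real.exp (-(1 / 2) * ‖x‖ ^ 2))) := by
  have hint : Integrable (fun x : EuclideanSpace ℝ (Fin d) ↦ Real.exp (-(1 / 2) * ‖x‖ ^ 2)) := by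
    have h := (GaussianFourier.integrable_cexp_neg_mul_sq_norm_add (b := (1 / 2 : ℂ))
      (by norm_num) 0 (0 : EuclideanSpace ℝ (Fin d))).re
    refine h.congr (ae_of_all _ fun x ↦ ?_)
    have : (-(1 / 2 : ℂ) * (‖x‖ : ℂ) ^ 2 + 0 * ((inner ℝ (0 : EuclideanSpace ℝ (Fin d)) x : ℝ) : ℂ))
      = ((-(1 / 2) * ‖x‖ ^ 2 : ℝ) : ℂ) := by push_cast; ring
    simp only [this]
    exact Complex.exp_ofReal_re _
  have hm : Measurable (fun x : EuclideanSpace ℝ (Fin d) ↦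
      (Real.sqrt ((2 * Real.pi) ^ d))⁻¹ * Real.exp (-(1 / 2) * ‖x‖ ^ 2)) := by fun_prop
  have hfin : IsFiniteMeasure ((volume : Measure (EuclideanSpace ℝ (Fin d))).withDensity
      (fun x ↦ ENNReal.ofReal ((Real.sqrt ((2 * Real.pi) ^ d))⁻¹ *
        Real.exp (-(1 / 2) * ‖x‖ ^ 2)))) :=
    isFiniteMeasure_withDensity_ofReal (hint.const_mul _).2
  -- Both sides are finite measures, so it suffices to compare characteristic functions; the right
  -- one is a Gaussian Fourier integral.
  refine Measure.ext_of_charFun (funext fun θ ↦ ?_)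
  rw [charFun_stdGaussian, charFun_apply,
    integral_withDensity_eq_integral_toReal_smul hm.ennreal_ofReal
      (ae_of_all _ fun _ ↦ ENNReal.ofReal_lt_top)]
  have h1 : ∀ x : EuclideanSpace ℝ (Fin d), (ENNReal.ofReal ((Real.sqrt ((2 * Real.pi) ^ d))⁻¹ *
      Real.exp (-(1 / 2) * ‖x‖ ^ 2))).toReal • Complex.exp (inner ℝ x θ * Complex.I) =
      ((Real.sqrt ((2 * Real.pi) ^ d))⁻¹ : ℝ) *
        Complex.exp (-(1 / 2 : ℂ) * ‖x‖ ^ 2 + Complex.I * (inner ℝ θ x : ℝ)) := fun x ↦ by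
    rw [ENNReal.toReal_ofReal (by positivity), Complex.real_smul, Complex.ofReal_mul,
      Complex.ofReal_exp, mul_assoc, ← Complex.exp_add, real_inner_comm]
    push_cast
    ring_nf
  simp_rw [h1]
  rw [integral_const_mul, GaussianFourier.integral_cexp_neg_mul_sq_norm_add (by norm_num),
    ← mul_assoc]
  have h2 : ((Real.sqrt ((2 * Real.pi) ^ d))⁻¹ : ℝ) *
      (Real.pi / (1 / 2 : ℂ)) ^ (Module.finrank ℝ (EuclideanSpace ℝ (Fin d)) / 2 : ℂ) = 1 := by
    have : (Real.pi / (1 / 2 : ℂ)) ^ (Module.finrank ℝ (EuclideanSpace ℝ (Fin d)) / 2 : ℂ) =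
        ((Real.sqrt ((2 * Real.pi) ^ d) : ℝ) : ℂ) := by
      have e : (Real.pi / (1 / 2 : ℂ)) = ((2 * Real.pi : ℝ) : ℂ) := by push_cast; ring
      have e2 : (Module.finrank ℝ (EuclideanSpace ℝ (Fin d)) / 2 : ℂ) = ((d / 2 : ℝ) : ℂ) := by
        simp
      rw [e, e2, ← Complex.ofReal_cpow (by positivity), Real.sqrt_eq_rpow, ← Real.rpow_natCast,
        ← Real.rpow_mul (by positivity)]
      congr 2
      ring
    rw [this, ← Complex.ofReal_mul, inv_mul_cancel₀ (by positivity), Complex.ofReal_one]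
  rw [h2, one_mul]
  congr 1
  rw [Complex.I_sq]
  ring

/-- Transports a density through a change of variables once the image of the reference measure is
known; used for the affine map defining a Gaussian and for the shear in the joint law. -/
lemma map_withDensity_comp {α β : Type*} [MeasurableSpace α] [MeasurableSpace β]
    (ν : Measure α) {e : α → β} (he : Measurable e) {g : β → ℝ≥0∞} (hg : Measurable g) :
    (ν.withDensity (g ∘ e)).map e = (ν.map e).withDensity g := by
  ext s hs
  rw [Measure.map_apply he hs, withDensity_apply _ (he hs), withDensity_apply _ hs,
    setLIntegral_map hs hg he]
  rfl

/-- The density of a nondegenerate Gaussian measure. -/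
lemma multivariateGaussian_eq_withDensity (m : EuclideanSpace ℝ (Fin d))
    {S : Matrix (Fin d) (Fin d) ℝ} (hS : S.PosDef) :
    multivariateGaussian m S =
      volume.withDensity (fun x ↦ ENNReal.ofReal (gaussDensity m S x)) := by
  -- The Gaussian is the image of the standard one under `x ↦ m + A x` with `A = √S`. This map
  -- scales Lebesgue measure by `|det A|⁻¹` and turns the quadratic form of `S⁻¹` into `‖x‖²`.
  open scoped MatrixOrder in
  set A := CFC.sqrt S with hA
  have hAA : A * A = S := CFC.sqrt_mul_sqrt_self _ hS.posSemidef.nonneg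
  have hdet : A.det * A.det = S.det := by rw [← Matrix.det_mul, hAA]
  have hA0 : A.det ≠ 0 := fun h ↦ by
    have := hS.det_pos
    simp [← hdet, h] at this
  have hAu : IsUnit A.det := isUnit_iff_ne_zero.2 hA0
  have hAsymm : A.IsHermitian := (CFC.sqrt_nonneg S).isSelfAdjoint
  have hmeas : Measurable (fun x ↦ m + act A x) := by fun_prop
  have hvol : (volume : Measure (EuclideanSpace ℝ (Fin d))).map (fun x ↦ m + act A x) =
      ENNReal.ofReal |A.det⁻¹| • volume := by
    have hd : LinearMap.det ((act A : EuclideanSpace ℝ (Fin d) →L[ℝ] EuclideanSpace ℝ (Fin d)) :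
        EuclideanSpace ℝ (Fin d) →ₗ[ℝ] EuclideanSpace ℝ (Fin d)) = A.det := det_act A
    have : (fun x ↦ m + act A x) = (fun x ↦ m + x) ∘ (act A) := rfl
    rw [this, ← Measure.map_map (by fun_prop) (by fun_prop)]
    have h2 := Measure.map_linearMap_addHaar_eq_smul_addHaar
      (volume : Measure (EuclideanSpace ℝ (Fin d))) (f := (act A).toLinearMap) (by rw [hd]; exact hA0)
    rw [hd] at h2
    erw [h2]
    rw [Measure.map_smul, map_add_left_eq_self]
  have hquad : ∀ v, inner ℝ (act A v) (act S⁻¹ (act A v)) = ‖v‖ ^ 2 := fun v ↦ by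
    have h4 : A * (S⁻¹ * A) = 1 := by
      rw [← hAA, Matrix.mul_inv_rev, Matrix.mul_assoc, Matrix.nonsing_inv_mul _ hAu,
        Matrix.mul_one, Matrix.mul_nonsing_inv _ hAu]
    rw [inner_act_left hAsymm, act_act, act_act, Matrix.mul_assoc, h4, act_one, real_inner_self_eq_norm_sq]
  rw [multivariateGaussian, stdGaussian_eq_withDensity, ← hA]
  have hdens : (fun x ↦ ENNReal.ofReal ((Real.sqrt ((2 * Real.pi) ^ d))⁻¹ *
        Real.exp (-(1 / 2) * ‖x‖ ^ 2))) = (fun x ↦ ENNReal.ofReal |A.det| *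
          ENNReal.ofReal (gaussDensity m S x)) ∘ (fun x ↦ m + act A x) := by
    ext x
    simp only [Function.comp_apply, gaussDensity, add_sub_cancel_left, hquad]
    rw [← ENNReal.ofReal_mul (by positivity), Real.sqrt_mul (by positivity), ← hdet,
      Real.sqrt_mul_self_eq_abs]
    congr 1
    field_simp
  rw [hdens, map_withDensity_comp _ hmeas (by have := (continuous_gaussDensity m S).measurable; fun_prop),
    hvol, withDensity_smul_measure]
  change _ • Measure.withDensity _ (ENNReal.ofReal |A.det| • fun x ↦ ENNReal.ofReal (gaussDensity m S x)) = _
  rw [withDensity_smul _ (by have := (continuous_gaussDensity m S).measurable; fun_prop), smul_smul,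
    ← ENNReal.ofReal_mul (by positivity), ← abs_mul, inv_mul_cancel₀ hA0]
  simp

lemma integrable_gaussDensity_smul {F : Type*} [NormedAddCommGroup F] [NormedSpace ℝ F]
    (m : EuclideanSpace ℝ (Fin d))
    {S : Matrix (Fin d) (Fin d) ℝ} (hS : S.PosDef) {g : EuclideanSpace ℝ (Fin d) → F} :
    Integrable (fun x ↦ gaussDensity m S x • g x) ↔ Integrable g (multivariateGaussian m S) := by
  rw [multivariateGaussian_eq_withDensity m hS, integrable_withDensity_iff_integrable_smul'
    (continuous_gaussDensity m S).measurable.ennreal_ofReal (by simp)]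
  simp_rw [ENNReal.toReal_ofReal (gaussDensity_pos m hS _).le]

lemma integrable_gaussDensity (m : EuclideanSpace ℝ (Fin d))
    {S : Matrix (Fin d) (Fin d) ℝ} (hS : S.PosDef) : Integrable (gaussDensity m S) := by
  simpa using (integrable_gaussDensity_smul m hS (g := fun _ ↦ (1 : ℝ))).2 (integrable_const _)

lemma integral_gaussDensity (m : EuclideanSpace ℝ (Fin d))
    {S : Matrix (Fin d) (Fin d) ℝ} (hS : S.PosDef) : ∫ x, gaussDensity m S x = 1 := by
  have h : ∫ _, (1 : ℝ) ∂(multivariateGaussian m S) = 1 := by simp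
  rw [multivariateGaussian_eq_withDensity m hS, integral_withDensity_eq_integral_toReal_smul
    (continuous_gaussDensity m S).measurable.ennreal_ofReal (by simp)] at h
  simpa [ENNReal.toReal_ofReal (gaussDensity_pos m hS _).le] using h

end GaussianDensity

/-! ### Gradients of Gaussian densities and the algebra of `J` -/

section Calculus

variable {d : ℕ}

lemma hasGradientAt_iff_hasFDerivAt_innerSL {E : Type*} [NormedAddCommGroup E]
    [InnerProductSpace ℝ E] [CompleteSpace E] {f : E → ℝ} {v x : E} :
    HasGradientAt f v x ↔ HasFDerivAt f (innerSL ℝ v) x := by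
  rw [hasGradientAt_iff_hasFDerivAt]
  rfl

/-- Integration by parts for gradients, without decay assumptions beyond integrability. -/
lemma integral_smul_gradient_eq_neg {E : Type*} [NormedAddCommGroup E]
    [InnerProductSpace ℝ E] [FiniteDimensional ℝ E] [MeasurableSpace E] [BorelSpace E]
    {G p : E → ℝ} {G' p' : E → E} (hG : ∀ x, HasGradientAt G (G' x) x)
    (hp : ∀ x, HasGradientAt p (p' x) x) (h1 : Integrable (fun x ↦ G x • p' x))
    (h2 : Integrable (fun x ↦ p x • G' x)) (h3 : Integrable (fun x ↦ G x * p x)) :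
    ∫ x, G x • p' x = -∫ x, p x • G' x := by
  -- Pairing with a fixed `v` reduces the vector identity to integration by parts for the
  -- directional derivative along `v`.
  refine ext_inner_left ℝ fun v ↦ ?_
  rw [inner_neg_right, ← integral_inner h1, ← integral_inner h2]
  have hfG : ∀ x, fderiv ℝ G x v = inner ℝ v (G' x) := fun x ↦ by
    rw [(hasGradientAt_iff_hasFDerivAt_innerSL.1 (hG x)).fderiv, innerSL_apply_apply,
      real_inner_comm]
  have hfp : ∀ x, fderiv ℝ p x v = inner ℝ v (p' x) := fun x ↦ by
    rw [(hasGradientAt_iff_hasFDerivAt_innerSL.1 (hp x)).fderiv, innerSL_apply_apply,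
      real_inner_comm]
  have h1' := h1.const_inner (𝕜 := ℝ) v
  have h2' := h2.const_inner (𝕜 := ℝ) v
  simp_rw [real_inner_smul_right] at h1' h2' ⊢
  have := integral_mul_fderiv_eq_neg_fderiv_mul_of_integrable (f := G) (g := p) (v := v)
    (μ := volume) (by simpa only [hfG, mul_comm] using h2') (by simpa only [hfp] using h1') h3
    (fun x _ ↦ (hG x).differentiableAt) (fun x _ ↦ (hp x).differentiableAt)
  simp_rw [hfG, hfp] at this
  rw [this]
  simp_rw [mul_comm]

/-- Exchanging point and mean reduces derivatives in the mean (of the likelihood in `M x`, of the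
transition density in `a • z₀`) to `hasGradientAt_gaussDensity`. -/
lemma gaussDensity_comm (m : EuclideanSpace ℝ (Fin d)) (S : Matrix (Fin d) (Fin d) ℝ)
    (x : EuclideanSpace ℝ (Fin d)) : gaussDensity m S x = gaussDensity x S m := by
  unfold gaussDensity
  rw [← neg_sub m x, map_neg, inner_neg_neg]

lemma hasGradientAt_gaussDensity (m : EuclideanSpace ℝ (Fin d)) {S : Matrix (Fin d) (Fin d) ℝ}
    (hS : S.PosDef) (x : EuclideanSpace ℝ (Fin d)) :
    HasGradientAt (gaussDensity m S) (-gaussDensity m S x • act S⁻¹ (x - m)) x := by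
  rw [hasGradientAt_iff_hasFDerivAt_innerSL]
  have h1 : HasFDerivAt (fun x ↦ x - m) (ContinuousLinearMap.id ℝ (EuclideanSpace ℝ (Fin d))) x :=
    (hasFDerivAt_id x).sub_const m
  have h2 := (h1.inner ℝ ((act S⁻¹).hasFDerivAt.comp x h1)).const_mul (-(1 / 2))
  have h3 := h2.exp.const_mul (Real.sqrt ((2 * Real.pi) ^ d * S.det))⁻¹
  refine h3.congr_fderiv ?_
  ext v
  have hs : inner ℝ (x - m) (act S⁻¹ v) = inner ℝ v (act S⁻¹ (x - m)) := by
    rw [← inner_act_left hS.inv.isHermitian, real_inner_comm]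
  simp only [smul_apply, ContinuousLinearMap.comp_apply,
    fderivInnerCLM_apply, ContinuousLinearMap.prod_apply, ContinuousLinearMap.id_apply,
    innerSL_apply_apply, real_inner_smul_left, smul_eq_mul, gaussDensity, hs, Function.comp_apply]
  rw [real_inner_comm v]
  ring

lemma posDef_sq_smul_one {c : ℝ} (hc : 0 < c) :
    (c ^ 2 • (1 : Matrix (Fin d) (Fin d) ℝ)).PosDef :=
  Matrix.PosDef.one.smul (by positivity)

lemma act_sq_smul_one_inv {c : ℝ} (hc : 0 < c) (x : EuclideanSpace ℝ (Fin d)) :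
    act (c ^ 2 • (1 : Matrix (Fin d) (Fin d) ℝ))⁻¹ x = (c ^ 2)⁻¹ • x := by
  have : (c ^ 2 • (1 : Matrix (Fin d) (Fin d) ℝ))⁻¹ = (c ^ 2)⁻¹ • 1 := by
    refine Matrix.inv_eq_right_inv ?_
    rw [smul_mul_smul_comm, mul_one, mul_inv_cancel₀ (by positivity), one_smul]
  rw [this, act, map_smul, map_one]
  rfl

lemma hasGradientAt_componentDensity_left {S : Matrix (Fin d) (Fin d) ℝ} (hS : S.PosDef)
    (a : ℝ) {c : ℝ} (hc : 0 < c) (m z₀ z : EuclideanSpace ℝ (Fin d)) :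
    HasGradientAt (fun x ↦ componentDensity S a c m x z)
      (-(componentDensity S a c m z₀ z) • (act S⁻¹ (z₀ - m) - (a / c ^ 2) • (z - a • z₀))) z₀ := by
  rw [hasGradientAt_iff_hasFDerivAt_innerSL]
  have h1 := hasGradientAt_iff_hasFDerivAt_innerSL.1 (hasGradientAt_gaussDensity m hS z₀)
  have h2 := hasGradientAt_iff_hasFDerivAt_innerSL.1
    (hasGradientAt_gaussDensity z (posDef_sq_smul_one hc) (a • z₀))
  have h3 := h1.mul (h2.comp z₀ ((hasFDerivAt_id z₀).const_smul a))
  have h4 : (fun x ↦ componentDensity S a c m x z) =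
      (gaussDensity m S * (gaussDensity z (c ^ 2 • 1) ∘ (a • id))) := by
    ext x
    simp only [componentDensity, gaussDensity_comm (a • x)]
    rfl
  rw [h4]
  refine h3.congr_fderiv ?_
  ext v
  simp only [act_sq_smul_one_inv hc]
  simp [componentDensity, gaussDensity_comm (a • z₀)]
  field_simp
  ring

lemma hasGradientAt_componentDensity_right (S : Matrix (Fin d) (Fin d) ℝ)
    (a : ℝ) {c : ℝ} (hc : 0 < c) (m z₀ z : EuclideanSpace ℝ (Fin d)) :
    HasGradientAt (fun x ↦ componentDensity S a c m z₀ x)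
      (-(componentDensity S a c m z₀ z) • (c ^ 2)⁻¹ • (z - a • z₀)) z := by
  rw [hasGradientAt_iff_hasFDerivAt_innerSL]
  have h2 := hasGradientAt_iff_hasFDerivAt_innerSL.1
    (hasGradientAt_gaussDensity (a • z₀) (posDef_sq_smul_one hc) z)
  refine (h2.const_mul (gaussDensity m S z₀)).congr_fderiv ?_
  rw [act_sq_smul_one_inv hc, ← map_smul, componentDensity, smul_smul, ← mul_neg]

lemma posDef_covT {S : Matrix (Fin d) (Fin d) ℝ} (hS : S.PosDef) (a : ℝ) {c : ℝ} (hc : 0 < c) :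
    (covT S a c).PosDef :=
  Matrix.PosDef.posSemidef_add (hS.posSemidef.smul (sq_nonneg a)) (posDef_sq_smul_one hc)

lemma covT_apply (S : Matrix (Fin d) (Fin d) ℝ) (a c : ℝ) (x : EuclideanSpace ℝ (Fin d)) :
    act (covT S a c) x = a ^ 2 • act S x + c ^ 2 • x := by
  simp only [act, covT, map_add, map_smul, map_one]
  rfl

lemma covT_inv_mul {S : Matrix (Fin d) (Fin d) ℝ} (hS : S.PosDef) (a : ℝ) {c : ℝ} (hc : 0 < c) :
    (covT S a c)⁻¹ * covT S a c = 1 :=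
  Matrix.nonsing_inv_mul _ (isUnit_iff_ne_zero.2 (posDef_covT hS a hc).det_pos.ne')

lemma covT_mul_inv {S : Matrix (Fin d) (Fin d) ℝ} (hS : S.PosDef) (a : ℝ) {c : ℝ} (hc : 0 < c) :
    covT S a c * (covT S a c)⁻¹ = 1 :=
  Matrix.mul_nonsing_inv _ (isUnit_iff_ne_zero.2 (posDef_covT hS a hc).det_pos.ne')

/-- `S` commutes with `Σ_t = a² S + c² I`, hence with its inverse. With `S` acting first, it cancels
the `S⁻¹` of the prior gradient. -/
lemma jacobianJ_eq {S : Matrix (Fin d) (Fin d) ℝ} (hS : S.PosDef) (a : ℝ) {c : ℝ} (hc : 0 < c) :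
    jacobianJ S a c = a • ((covT S a c)⁻¹ * S) := by
  have h : covT S a c * S = S * covT S a c := by simp [covT, add_mul, mul_add]
  have h2 : S * (covT S a c)⁻¹ = (covT S a c)⁻¹ * S := by
    calc S * (covT S a c)⁻¹ = (covT S a c)⁻¹ * (covT S a c * S) * (covT S a c)⁻¹ := by
          rw [← mul_assoc, covT_inv_mul hS a hc, one_mul]
      _ = (covT S a c)⁻¹ * S := by
          rw [h, mul_assoc, mul_assoc, covT_mul_inv hS a hc, mul_one]
  rw [jacobianJ, h2]

/-- The core identity: multiplied by `-q_k`, it reads `J ∇_{z₀} q_k = s_k q_k - ∇_z q_k`. Applying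
`Σ_t` to both sides leaves `a (z₀ - m) - (a²/c²) S (z - a z₀)`; on the right, the terms free of `S`
combine because `(z - a m) - (z - a z₀) = a (z₀ - m)`. -/
lemma act_jacobianJ_score {S : Matrix (Fin d) (Fin d) ℝ} (hS : S.PosDef) (a : ℝ) {c : ℝ}
    (hc : 0 < c) (m z₀ z : EuclideanSpace ℝ (Fin d)) :
    act (jacobianJ S a c) (act S⁻¹ (z₀ - m) - (a / c ^ 2) • (z - a • z₀)) =
      -componentScore S a c m z - (c ^ 2)⁻¹ • (z - a • z₀) := by
  have hJ : ∀ x, act (jacobianJ S a c) x = act (covT S a c)⁻¹ (a • act S x) := fun x ↦ by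
    rw [jacobianJ_eq hS a hc, map_smul, act_act, act, map_smul]
    rfl
  have hI : ∀ x, x = act (covT S a c)⁻¹ (act (covT S a c) x) := fun x ↦ by
    rw [act_act, covT_inv_mul hS a hc, act_one]
  have hSS : act S (act S⁻¹ (z₀ - m)) = z₀ - m := by
    rw [act_act, Matrix.mul_nonsing_inv _ (isUnit_iff_ne_zero.2 hS.det_pos.ne'), act_one]
  rw [hJ, hI ((c ^ 2)⁻¹ • (z - a • z₀)), componentScore, neg_neg, ← map_sub]
  congr 1
  rw [covT_apply, map_sub, hSS, map_smul, map_smul]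
  match_scalars <;> field_simp
  ring

/-- Expand `Σ_t Σ_t⁻¹ = 1` and solve for `S Σ_t⁻¹`; this is the form in which the derivative of
Tweedie's formula appears. -/
lemma jacobianJ_eq_sub {S : Matrix (Fin d) (Fin d) ℝ} (hS : S.PosDef) {a c : ℝ} (ha : 0 < a)
    (hc : 0 < c) : jacobianJ S a c = a⁻¹ • (1 - c ^ 2 • (covT S a c)⁻¹) := by
  have h : (1 : Matrix (Fin d) (Fin d) ℝ) =
      a ^ 2 • (S * (covT S a c)⁻¹) + c ^ 2 • (covT S a c)⁻¹ := by
    conv_lhs => rw [← covT_mul_inv hS a hc, covT, add_mul, smul_mul_assoc, smul_mul_assoc, one_mul]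
    rfl
  rw [h, add_sub_cancel_right, smul_smul, jacobianJ]
  congr 1
  field_simp

end Calculus

/-! ### Integrability and differentiation of the component integrals -/

section ComponentIntegrals

variable {d : ℕ}

/-- Functions of at most linear growth are integrable against a Gaussian density. -/
lemma integrable_gaussDensity_smul_of_le {F : Type*} [NormedAddCommGroup F] [NormedSpace ℝ F]
    (m : EuclideanSpace ℝ (Fin d)) {S : Matrix (Fin d) (Fin d) ℝ} (hS : S.PosDef)
    {g : EuclideanSpace ℝ (Fin d) → F} (hg : Continuous g) {A B : ℝ}
    (hle : ∀ x, ‖g x‖ ≤ A + B * ‖x‖) : Integrable (fun x ↦ gaussDensity m S x • g x) := by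
  rw [integrable_gaussDensity_smul m hS]
  exact Integrable.mono' ((integrable_const A).add (IsGaussian.integrable_id.norm.const_mul B))
    hg.aestronglyMeasurable (ae_of_all _ hle)

lemma continuous_componentDensity (S : Matrix (Fin d) (Fin d) ℝ) (a c : ℝ)
    (m : EuclideanSpace ℝ (Fin d)) :
    Continuous (fun p : EuclideanSpace ℝ (Fin d) × EuclideanSpace ℝ (Fin d) ↦
      componentDensity S a c m p.1 p.2) := by
  unfold componentDensity gaussDensity
  fun_prop

lemma continuous_componentDensity_left (S : Matrix (Fin d) (Fin d) ℝ) (a c : ℝ)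
    (m z : EuclideanSpace ℝ (Fin d)) : Continuous (fun x ↦ componentDensity S a c m x z) := by
  unfold componentDensity gaussDensity
  fun_prop

lemma componentDensity_pos {S : Matrix (Fin d) (Fin d) ℝ} (hS : S.PosDef) (a : ℝ) {c : ℝ}
    (hc : 0 < c) (m z₀ z : EuclideanSpace ℝ (Fin d)) : 0 < componentDensity S a c m z₀ z :=
  mul_pos (gaussDensity_pos _ hS _) (gaussDensity_pos _ (posDef_sq_smul_one hc) _)

/-- The maximum of the transition density. -/
noncomputable def transitionBound (d : ℕ) (c : ℝ) : ℝ :=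
  (Real.sqrt ((2 * Real.pi) ^ d * (c ^ 2 • (1 : Matrix (Fin d) (Fin d) ℝ)).det))⁻¹

lemma transitionBound_nonneg (d : ℕ) (c : ℝ) : 0 ≤ transitionBound d c := by
  unfold transitionBound
  positivity

/-- The bound is uniform in `z`, as domination under the integral sign requires, and it keeps the
Gaussian decay in `z₀`. -/
lemma componentDensity_le {S : Matrix (Fin d) (Fin d) ℝ} (hS : S.PosDef) (a : ℝ) {c : ℝ}
    (hc : 0 < c) (m z₀ z : EuclideanSpace ℝ (Fin d)) :
    componentDensity S a c m z₀ z ≤ gaussDensity m S z₀ * transitionBound d c :=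
  mul_le_mul_of_nonneg_left (gaussDensity_le _ (posDef_sq_smul_one hc) _)
    (gaussDensity_pos _ hS _).le

lemma integrable_componentDensity_smul_of_le {F : Type*} [NormedAddCommGroup F] [NormedSpace ℝ F]
    {S : Matrix (Fin d) (Fin d) ℝ} (hS : S.PosDef) (a : ℝ) {c : ℝ} (hc : 0 < c)
    (m z : EuclideanSpace ℝ (Fin d)) {g : EuclideanSpace ℝ (Fin d) → F} (hg : Continuous g)
    {A B : ℝ} (hle : ∀ x, ‖g x‖ ≤ A + B * ‖x‖) :
    Integrable (fun x ↦ componentDensity S a c m x z • g x) := by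
  refine Integrable.mono' ((integrable_gaussDensity_smul_of_le m hS hg hle).norm.mul_const
    (transitionBound d c))
    ((continuous_componentDensity_left S a c m z).smul hg).aestronglyMeasurable
    (ae_of_all _ fun x ↦ ?_)
  rw [norm_smul, norm_smul, Real.norm_of_nonneg (componentDensity_pos hS a hc m x z).le,
    Real.norm_of_nonneg (gaussDensity_pos m hS x).le, mul_right_comm]
  exact mul_le_mul_of_nonneg_right (componentDensity_le hS a hc m x z) (norm_nonneg _)

variable {S : Matrix (Fin d) (Fin d) ℝ} {a c : ℝ} {p : EuclideanSpace ℝ (Fin d) → ℝ} {B : ℝ}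

lemma integrable_componentDensity_mul (hS : S.PosDef) (a : ℝ) (hc : 0 < c)
    (m z : EuclideanSpace ℝ (Fin d)) (hp : Continuous p) (hp0 : ∀ x, 0 < p x) (hpB : ∀ x, p x ≤ B) :
    Integrable (fun x ↦ componentDensity S a c m x z * p x) :=
  integrable_componentDensity_smul_of_le hS a hc m z hp (A := B) (B := 0) fun x ↦ by
    rw [Real.norm_of_nonneg (hp0 x).le, zero_mul, add_zero]
    exact hpB x

/-- Both gradients of `q_k` are `q_k` times an affine function of `z₀`; as `p` is bounded, the first
Gaussian moment suffices. -/
lemma integrable_mul_componentDensity_smul_affine (hS : S.PosDef) (a : ℝ) (hc : 0 < c)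
    (m z : EuclideanSpace ℝ (Fin d)) (hp : Continuous p) (hp0 : ∀ x, 0 < p x) (hpB : ∀ x, p x ≤ B)
    (A : EuclideanSpace ℝ (Fin d) →L[ℝ] EuclideanSpace ℝ (Fin d)) (v : EuclideanSpace ℝ (Fin d)) :
    Integrable (fun x ↦ p x • componentDensity S a c m x z • (A x + v)) := by
  have hB : 0 ≤ B := (hp0 0).le.trans (hpB 0)
  have h := integrable_componentDensity_smul_of_le hS a hc m z (g := fun x ↦ p x • (A x + v))
    (by fun_prop) (A := B * ‖v‖) (B := B * ‖A‖) fun x ↦ by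
      rw [norm_smul, Real.norm_of_nonneg (hp0 x).le]
      calc p x * ‖A x + v‖ ≤ B * (‖A‖ * ‖x‖ + ‖v‖) :=
            mul_le_mul (hpB x) ((norm_add_le _ _).trans (by gcongr; exact A.le_opNorm x))
              (norm_nonneg _) hB
        _ = B * ‖v‖ + B * ‖A‖ * ‖x‖ := by ring
  exact h.congr (ae_of_all _ fun x ↦ smul_comm _ _ _)

lemma integral_componentDensity_mul_pos (hS : S.PosDef) (a : ℝ) (hc : 0 < c)
    (m z : EuclideanSpace ℝ (Fin d)) (hp : Continuous p) (hp0 : ∀ x, 0 < p x)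
    (hpB : ∀ x, p x ≤ B) : 0 < ∫ x, componentDensity S a c m x z * p x := by
  have hpos : ∀ x, 0 < componentDensity S a c m x z * p x := fun x ↦
    mul_pos (componentDensity_pos hS a hc m x z) (hp0 x)
  rw [integral_pos_iff_support_of_nonneg (fun x ↦ (hpos x).le)
    (integrable_componentDensity_mul hS a hc m z hp hp0 hpB)]
  have : Function.support (fun x ↦ componentDensity S a c m x z * p x) = univ :=
    eq_univ_of_forall fun x ↦ (hpos x).ne'
  rw [this]
  exact isOpen_univ.measure_pos _ univ_nonempty

/-- By Tonelli, integrate in `z` first: the transition density has mass one, and a bounded function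
against the prior density remains. -/
lemma integrable_integral_componentDensity_mul (hS : S.PosDef) (a : ℝ) (hc : 0 < c)
    (m : EuclideanSpace ℝ (Fin d)) (hp : Continuous p) (hp0 : ∀ x, 0 < p x)
    (hpB : ∀ x, p x ≤ B) : Integrable (fun z ↦ ∫ x, componentDensity S a c m x z * p x) := by
  refine Integrable.integral_prod_right (μ := volume) (ν := volume)
    (f := fun q : EuclideanSpace ℝ (Fin d) × EuclideanSpace ℝ (Fin d) ↦
      componentDensity S a c m q.1 q.2 * p q.1) ?_
  have hcont : Continuous (fun q : EuclideanSpace ℝ (Fin d) × EuclideanSpace ℝ (Fin d) ↦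
      componentDensity S a c m q.1 q.2 * p q.1) :=
    (continuous_componentDensity S a c m).mul (hp.comp continuous_fst)
  rw [integrable_prod_iff hcont.aestronglyMeasurable]
  have hC := posDef_sq_smul_one (d := d) hc
  constructor
  · refine ae_of_all _ fun x ↦ ?_
    exact ((integrable_gaussDensity (a • x) hC).const_mul (gaussDensity m S x)).mul_const (p x)
  · have : ∀ x, ∫ z, ‖componentDensity S a c m x z * p x‖ = gaussDensity m S x • p x := fun x ↦ by
      have h : ∀ z, ‖componentDensity S a c m x z * p x‖ =
          gaussDensity m S x * p x * gaussDensity (a • x) (c ^ 2 • 1) z := fun z ↦ by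
        rw [Real.norm_of_nonneg (mul_pos (componentDensity_pos hS a hc m x z) (hp0 x)).le,
          componentDensity]
        ring
      simp_rw [h]
      rw [integral_const_mul, integral_gaussDensity _ hC, mul_one, smul_eq_mul]
    simp_rw [this]
    refine integrable_gaussDensity_smul_of_le m hS hp (A := B) (B := 0) fun x ↦ ?_
    rw [Real.norm_of_nonneg (hp0 x).le, zero_mul, add_zero]
    exact hpB x

lemma hasGradientAt_integral_componentDensity_mul (hS : S.PosDef) (a : ℝ) (hc : 0 < c)
    (m z : EuclideanSpace ℝ (Fin d)) (hp : Continuous p) (hp0 : ∀ x, 0 < p x)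
    (hpB : ∀ x, p x ≤ B) :
    HasGradientAt (fun z ↦ ∫ x, componentDensity S a c m x z * p x)
      (∫ x, p x • componentDensity S a c m x z • -((c ^ 2)⁻¹ • (z - a • x))) z := by
  have hB : 0 ≤ B := (hp0 0).le.trans (hpB 0)
  rw [hasGradientAt_iff_hasFDerivAt_innerSL]
  have hint := integrable_mul_componentDensity_smul_affine hS a hc m z hp hp0 hpB
    (((c ^ 2)⁻¹ * a) • ContinuousLinearMap.id ℝ _) (-((c ^ 2)⁻¹ • z))
  have hrw : ∀ x, (((c ^ 2)⁻¹ * a) • ContinuousLinearMap.id ℝ (EuclideanSpace ℝ (Fin d))) x +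
      (-((c ^ 2)⁻¹ • z)) = -((c ^ 2)⁻¹ • (z - a • x)) := fun x ↦ by
    simp only [smul_apply, ContinuousLinearMap.id_apply]
    module
  simp_rw [hrw] at hint
  rw [← ContinuousLinearMap.integral_comp_comm _ hint]
  -- On the unit ball around `z` one has `‖z' - a x‖ ≤ ‖z‖ + 1 + |a| ‖x‖`, which gives a bound
  -- independent of `z'` and integrable in `x`.
  refine hasFDerivAt_integral_of_dominated_of_fderiv_le
    (bound := fun x ↦ ‖gaussDensity m S x •
      (B * transitionBound d c * (c ^ 2)⁻¹ * (‖z‖ + 1 + |a| * ‖x‖))‖)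
    (F' := fun z x ↦ innerSL ℝ (p x • componentDensity S a c m x z • -((c ^ 2)⁻¹ • (z - a • x))))
    (Metric.ball_mem_nhds z one_pos)
    (Eventually.of_forall fun z' ↦
      ((continuous_componentDensity_left S a c m z').mul hp).aestronglyMeasurable)
    (integrable_componentDensity_mul hS a hc m z hp hp0 hpB) ?_ ?_ ?_ ?_
  · exact (innerSL ℝ).continuous.comp_aestronglyMeasurable hint.1
  · refine ae_of_all _ fun x z' hz' ↦ ?_
    rw [innerSL_apply_norm, norm_smul, norm_smul, norm_neg, norm_smul, norm_smul,
      Real.norm_of_nonneg (hp0 x).le, Real.norm_of_nonneg (componentDensity_pos hS a hc m x z').le,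
      Real.norm_of_nonneg (gaussDensity_pos m hS x).le,
      Real.norm_of_nonneg (by positivity : (0 : ℝ) ≤ (c ^ 2)⁻¹),
      Real.norm_of_nonneg (by have := transitionBound_nonneg d c; positivity)]
    have hz : ‖z'‖ ≤ ‖z‖ + 1 := by
      have h1 := norm_sub_norm_le z' z
      have h2 := mem_ball_iff_norm.1 hz'
      linarith
    have h1 : ‖z' - a • x‖ ≤ ‖z‖ + 1 + |a| * ‖x‖ := by
      refine (norm_sub_le _ _).trans ?_
      rw [norm_smul, Real.norm_eq_abs]
      gcongr
    have h2 := componentDensity_le hS a hc m x z'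
    have h0 := (componentDensity_pos hS a hc m x z').le
    calc p x * (componentDensity S a c m x z' * ((c ^ 2)⁻¹ * ‖z' - a • x‖))
        ≤ B * (gaussDensity m S x * transitionBound d c *
          ((c ^ 2)⁻¹ * (‖z‖ + 1 + |a| * ‖x‖))) := by
          have := hpB x
          have := hp0 x
          have := h0.trans h2
          gcongr
      _ = _ := by ring
  · refine (integrable_gaussDensity_smul_of_le m hS (by fun_prop)
      (A := B * transitionBound d c * (c ^ 2)⁻¹ * (‖z‖ + 1))
      (B := B * transitionBound d c * (c ^ 2)⁻¹ * |a|) fun x ↦ ?_).norm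
    rw [Real.norm_of_nonneg (by have := transitionBound_nonneg d c; positivity)]
    exact le_of_eq (by ring)
  · refine ae_of_all _ fun x z' _ ↦ ?_
    have h := hasGradientAt_iff_hasFDerivAt_innerSL.1
      (hasGradientAt_componentDensity_right S a hc m x z')
    refine (h.mul_const (p x)).congr_fderiv ?_
    rw [← map_smul, neg_smul, smul_neg, smul_neg, smul_neg]

end ComponentIntegrals

/-! ### Tweedie's formula and the posterior score -/

section ScoreFormula

variable {d r K : ℕ} {S : Matrix (Fin d) (Fin d) ℝ} {a c : ℝ}

lemma integrable_mul_componentDensity_smul_score (hS : S.PosDef) (a : ℝ) (hc : 0 < c)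
    {p : EuclideanSpace ℝ (Fin d) → ℝ} {B : ℝ}
    (m z : EuclideanSpace ℝ (Fin d)) (hp : Continuous p) (hp0 : ∀ x, 0 < p x)
    (hpB : ∀ x, p x ≤ B) :
    Integrable (fun x ↦ p x • componentDensity S a c m x z •
      (act S⁻¹ (x - m) - (a / c ^ 2) • (z - a • x))) := by
  have h := integrable_mul_componentDensity_smul_affine hS a hc m z hp hp0 hpB
    (act S⁻¹ + (a / c ^ 2 * a) • ContinuousLinearMap.id ℝ _) (-act S⁻¹ m - (a / c ^ 2) • z)
  refine h.congr (ae_of_all _ fun x ↦ ?_)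
  simp only [add_apply, smul_apply, ContinuousLinearMap.id_apply, map_sub]
  congr 2
  module

/-- Tweedie's formula, obtained without completing the square: apply `J` to the vanishing integral
of `∇_{z₀} q` and solve for the first moment. -/
lemma reverseMean_eq (hS : S.PosDef) (ha : 0 < a) (hc : 0 < c) (m z : EuclideanSpace ℝ (Fin d)) :
    reverseMean S a c m z = a⁻¹ • (z + c ^ 2 • componentScore S a c m z) := by
  have hp : Continuous (fun _ : EuclideanSpace ℝ (Fin d) ↦ (1 : ℝ)) := continuous_const
  have hN := integral_componentDensity_mul_pos hS a hc m z hp (fun _ ↦ one_pos) (fun _ ↦ le_rfl)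
  have hqi := integrable_componentDensity_mul hS a hc m z hp (fun _ ↦ one_pos) (fun _ ↦ le_rfl)
  have hsc := integrable_mul_componentDensity_smul_score hS a hc m z hp (fun _ ↦ one_pos)
    (fun _ ↦ le_rfl)
  have hid := integrable_mul_componentDensity_smul_affine hS a hc m z hp (fun _ ↦ one_pos)
    (fun _ ↦ le_rfl) (ContinuousLinearMap.id ℝ _) 0
  simp only [mul_one, one_smul, add_zero, ContinuousLinearMap.id_apply] at hN hqi hsc hid
  -- Integration by parts against the constant `1`: the integral of a gradient vanishes.
  have hzero : ∫ x, componentDensity S a c m x z •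
      (act S⁻¹ (x - m) - (a / c ^ 2) • (z - a • x)) = 0 := by
    have h := integral_smul_gradient_eq_neg (G := fun x ↦ componentDensity S a c m x z)
      (p := fun _ ↦ (1 : ℝ)) (p' := fun _ ↦ 0)
      (fun x ↦ hasGradientAt_componentDensity_left hS a hc m x z)
      (fun x ↦ hasGradientAt_const x _) (by simp)
      (by
        simp only [neg_smul, one_smul]
        exact hsc.neg)
      (by simpa using hqi)
    simpa only [smul_zero, integral_zero, one_smul, neg_smul, integral_neg, neg_neg] using h.symm
  have h := congrArg (act (jacobianJ S a c)) hzero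
  rw [← ContinuousLinearMap.integral_comp_comm _ hsc, map_zero] at h
  simp_rw [map_smul, act_jacobianJ_score hS a hc] at h
  have hsplit : ∀ x, componentDensity S a c m x z •
      (-componentScore S a c m z - (c ^ 2)⁻¹ • (z - a • x)) =
      componentDensity S a c m x z • (-componentScore S a c m z - (c ^ 2)⁻¹ • z) +
        ((c ^ 2)⁻¹ * a) • componentDensity S a c m x z • x := fun x ↦ by module
  simp_rw [hsplit] at h
  rw [integral_add (hqi.smul_const _) (hid.fun_smul _), integral_smul_const, integral_smul] at h
  set N := ∫ x, componentDensity S a c m x z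
  have h2 := eq_neg_of_add_eq_zero_right h
  rw [reverseMean]
  calc N⁻¹ • ∫ x, componentDensity S a c m x z • x
      = (N⁻¹ * (c ^ 2 * a⁻¹)) • (((c ^ 2)⁻¹ * a) • ∫ x, componentDensity S a c m x z • x) := by
        rw [smul_smul]
        congr 1
        field_simp
    _ = a⁻¹ • (z + c ^ 2 • componentScore S a c m z) := by
        rw [h2]
        match_scalars <;> field_simp

theorem hasFDerivAt_reverseMean (hS : S.PosDef) (ha : 0 < a) (hc : 0 < c)
    (m z : EuclideanSpace ℝ (Fin d)) :
    HasFDerivAt (reverseMean S a c m) (act (jacobianJ S a c)) z := by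
  have h : reverseMean S a c m = fun z ↦ a⁻¹ • (z + c ^ 2 • -act (covT S a c)⁻¹ (z - a • m)) :=
    funext fun z ↦ reverseMean_eq hS ha hc m z
  have hd : HasFDerivAt (fun z ↦ a⁻¹ • (z + c ^ 2 • -act (covT S a c)⁻¹ (z - a • m)))
      (a⁻¹ • (ContinuousLinearMap.id ℝ (EuclideanSpace ℝ (Fin d)) +
        c ^ 2 • -(act (covT S a c)⁻¹))) z :=
    ((hasFDerivAt_id z).add (((act (covT S a c)⁻¹).hasFDerivAt.comp z
      ((hasFDerivAt_id z).sub_const (a • m))).neg.const_smul (c ^ 2))).const_smul a⁻¹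
  rw [h]
  refine hd.congr_fderiv ?_
  rw [jacobianJ_eq_sub hS ha hc]
  simp only [act, map_smul, map_sub, map_one]
  rw [smul_neg, sub_eq_add_neg]
  rfl

variable {M : EuclideanSpace ℝ (Fin d) → EuclideanSpace ℝ (Fin r)}
  {Sobs : Matrix (Fin r) (Fin r) ℝ} {w : Fin K → ℝ} {μ : Fin K → EuclideanSpace ℝ (Fin d)}

lemma likelihood_pos (hSobs : Sobs.PosDef) (y : EuclideanSpace ℝ (Fin r))
    (x : EuclideanSpace ℝ (Fin d)) : 0 < likelihood M Sobs y x :=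
  gaussDensity_pos _ hSobs _

lemma likelihood_le (hSobs : Sobs.PosDef) (y : EuclideanSpace ℝ (Fin r))
    (x : EuclideanSpace ℝ (Fin d)) :
    likelihood M Sobs y x ≤ (Real.sqrt ((2 * Real.pi) ^ r * Sobs.det))⁻¹ :=
  gaussDensity_le _ hSobs _

/-- Differentiate `p = exp (log p)`. This is how the likelihood score enters after integration by
parts. -/
lemma hasGradientAt_likelihood (hM : Differentiable ℝ M) (hSobs : Sobs.PosDef)
    (y : EuclideanSpace ℝ (Fin r)) (x : EuclideanSpace ℝ (Fin d)) :
    HasGradientAt (likelihood M Sobs y) (likelihood M Sobs y x • likelihoodScore M Sobs y x) x := by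
  have hd : DifferentiableAt ℝ (likelihood M Sobs y) x := by
    have h : likelihood M Sobs y = gaussDensity y Sobs ∘ M :=
      funext fun x ↦ gaussDensity_comm _ _ _
    rw [h]
    exact (hasGradientAt_gaussDensity y hSobs (M x)).differentiableAt.comp x (hM x)
  have hlog : HasGradientAt (fun x ↦ Real.log (likelihood M Sobs y x))
      (likelihoodScore M Sobs y x) x :=
    (hd.log (likelihood_pos hSobs y x).ne').hasGradientAt
  rw [hasGradientAt_iff_hasFDerivAt_innerSL] at hlog ⊢
  have h := hlog.exp
  simp only [Real.exp_log (likelihood_pos hSobs y _)] at h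
  rw [map_smul]
  exact h

lemma continuous_likelihood (hM : Continuous M) (y : EuclideanSpace ℝ (Fin r)) :
    Continuous (likelihood M Sobs y) := by
  unfold likelihood gaussDensity
  fun_prop

lemma integral_jointDensity (k : Fin K) (z : EuclideanSpace ℝ (Fin d))
    (y : EuclideanSpace ℝ (Fin r)) :
    ∫ z₀, jointDensity w μ S a c M Sobs k z₀ z y =
      w k * ∫ z₀, componentDensity S a c (μ k) z₀ z * likelihood M Sobs y z₀ := by
  simp_rw [jointDensity, mul_assoc]
  rw [integral_const_mul]

lemma densityZtY_jointDensity_pos (hS : S.PosDef) (hc : 0 < c) (hM : Continuous M)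
    (hSobs : Sobs.PosDef) (hw : ∀ k, 0 ≤ w k) (hw_sum : ∑ k, w k = 1)
    (z : EuclideanSpace ℝ (Fin d)) (y : EuclideanSpace ℝ (Fin r)) :
    0 < densityZtY (jointDensity w μ S a c M Sobs) z y := by
  have hN := fun k ↦ integral_componentDensity_mul_pos hS a hc (μ k) z
    (continuous_likelihood (Sobs := Sobs) hM y) (likelihood_pos hSobs y) (likelihood_le hSobs y)
  simp_rw [densityZtY, integral_jointDensity]
  obtain ⟨k, -, hk⟩ := Finset.exists_ne_zero_of_sum_ne_zero (hw_sum.trans_ne one_ne_zero)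
  exact Finset.sum_pos' (fun i _ ↦ mul_nonneg (hw i) (hN i).le)
    ⟨k, Finset.mem_univ k, mul_pos ((hw k).lt_of_ne' hk) (hN k)⟩

lemma densityY_jointDensity_pos (hS : S.PosDef) (hc : 0 < c) (hM : Continuous M)
    (hSobs : Sobs.PosDef) (hw : ∀ k, 0 ≤ w k) (hw_sum : ∑ k, w k = 1)
    (y : EuclideanSpace ℝ (Fin r)) :
    0 < densityY (jointDensity w μ S a c M Sobs) y := by
  have hpos := fun z ↦ densityZtY_jointDensity_pos (a := a) (μ := μ) hS hc hM hSobs hw hw_sum z y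
  -- Integrability matters here: the integral of a non-integrable function is zero by convention,
  -- which would spoil positivity.
  have hint : Integrable (fun z ↦ densityZtY (jointDensity w μ S a c M Sobs) z y) := by
    simp_rw [densityZtY, integral_jointDensity]
    exact integrable_finsetSum _ fun k _ ↦ (integrable_integral_componentDensity_mul hS a hc (μ k)
      (continuous_likelihood hM y) (likelihood_pos hSobs y) (likelihood_le hSobs y)).const_mul _
  rw [densityY, integral_pos_iff_support_of_nonneg (fun z ↦ (hpos z).le) hint,
    show Function.support (fun z ↦ densityZtY (jointDensity w μ S a c M Sobs) z y) = univ from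
      eq_univ_of_forall fun z ↦ (hpos z).ne']
  exact isOpen_univ.measure_pos _ univ_nonempty

theorem condDensityZt_jointDensity_pos (hS : S.PosDef) (hc : 0 < c) (hM : Continuous M)
    (hSobs : Sobs.PosDef) (hw : ∀ k, 0 ≤ w k) (hw_sum : ∑ k, w k = 1)
    (z : EuclideanSpace ℝ (Fin d)) (y : EuclideanSpace ℝ (Fin r)) :
    0 < condDensityZt (jointDensity w μ S a c M Sobs) z y :=
  div_pos (densityZtY_jointDensity_pos hS hc hM hSobs hw hw_sum z y)
    (densityY_jointDensity_pos hS hc hM hSobs hw hw_sum y)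

lemma HasGradientAt.finset_sum_const_mul {ι E : Type*} [NormedAddCommGroup E]
    [InnerProductSpace ℝ E] [CompleteSpace E] (s : Finset ι) (w : ι → ℝ) {f : ι → E → ℝ}
    {f' : ι → E} {x : E} (h : ∀ i ∈ s, HasGradientAt (f i) (f' i) x) :
    HasGradientAt (fun x ↦ ∑ i ∈ s, w i * f i x) (∑ i ∈ s, w i • f' i) x := by
  simp_rw [hasGradientAt_iff_hasFDerivAt_innerSL] at h ⊢
  refine (HasFDerivAt.fun_sum fun i hi ↦ (h i hi).const_mul (w i)).congr_fderiv ?_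
  simp_rw [map_sum, map_smul]

/-- Integrate `∇_z q_k = s_k q_k - J ∇_{z₀} q_k` against `p` and integrate by parts. This is done
for the whole mixture `∑ w_k q_k`, since that is the integrand covered by the integrability
hypothesis; the terms with `∇_{z₀} q_k` are integrable anyway. -/
lemma hasGradientAt_densityZtY (hS : S.PosDef) (hc : 0 < c) (hM : Differentiable ℝ M)
    (hSobs : Sobs.PosDef) (z : EuclideanSpace ℝ (Fin d)) (y : EuclideanSpace ℝ (Fin r))
    (hint : Integrable (fun z₀ ↦ (∑ k, jointDensity w μ S a c M Sobs k z₀ z y) •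
      likelihoodScore M Sobs y z₀)) :
    HasGradientAt (fun z' ↦ densityZtY (jointDensity w μ S a c M Sobs) z' y)
      (∑ k, (∫ z₀, jointDensity w μ S a c M Sobs k z₀ z y) • componentScore S a c (μ k) z +
        act (jacobianJ S a c) (∫ z₀, (∑ k, jointDensity w μ S a c M Sobs k z₀ z y) •
          likelihoodScore M Sobs y z₀)) z := by
  have hp := continuous_likelihood (Sobs := Sobs) hM.continuous y
  have hp0 := likelihood_pos (M := M) hSobs y
  have hpB := likelihood_le (M := M) hSobs y
  set p := likelihood M Sobs y
  have hqi := fun k ↦ integrable_componentDensity_mul hS a hc (μ k) z hp hp0 hpB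
  have hsc := fun k ↦ integrable_mul_componentDensity_smul_score hS a hc (μ k) z hp hp0 hpB
  have hF : ∀ x, (∑ k, jointDensity w μ S a c M Sobs k x z y) • likelihoodScore M Sobs y x =
      (∑ k, w k * componentDensity S a c (μ k) x z) • p x • likelihoodScore M Sobs y x :=
    fun x ↦ by simp_rw [jointDensity]; rw [← Finset.sum_mul, mul_smul]
  have hibp : ∫ x, (∑ k, jointDensity w μ S a c M Sobs k x z y) • likelihoodScore M Sobs y x =
      ∑ k, w k • ∫ x, p x • componentDensity S a c (μ k) x z •
        (act S⁻¹ (x - μ k) - (a / c ^ 2) • (z - a • x)) := by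
    have hvec : ∀ x, p x • ∑ k, w k • -(componentDensity S a c (μ k) x z) •
        (act S⁻¹ (x - μ k) - (a / c ^ 2) • (z - a • x)) =
        -∑ k, w k • p x • componentDensity S a c (μ k) x z •
        (act S⁻¹ (x - μ k) - (a / c ^ 2) • (z - a • x)) := fun x ↦ by
      rw [Finset.smul_sum, ← Finset.sum_neg_distrib]
      exact Finset.sum_congr rfl fun k _ ↦ by rw [smul_comm, neg_smul, smul_neg, smul_neg]
    have h := integral_smul_gradient_eq_neg
      (G := fun x ↦ ∑ k, w k * componentDensity S a c (μ k) x z) (p := p)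
      (fun x ↦ HasGradientAt.finset_sum_const_mul Finset.univ w
        fun k _ ↦ hasGradientAt_componentDensity_left hS a hc (μ k) x z)
      (fun x ↦ hasGradientAt_likelihood hM hSobs y x) (by simpa only [hF] using hint)
      (by
        simp_rw [hvec]
        exact (integrable_finsetSum _ fun k _ ↦ (hsc k).smul (w k)).neg)
      (by
        simp_rw [Finset.sum_mul, mul_assoc]
        exact integrable_finsetSum _ fun k _ ↦ (hqi k).const_mul (w k))
    simp_rw [hF]
    rw [h]
    simp_rw [hvec]
    rw [integral_neg, neg_neg, integral_finsetSum _ fun k _ ↦ (hsc k).fun_smul (w k)]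
    simp_rw [integral_smul]
  have hgrad := HasGradientAt.finset_sum_const_mul Finset.univ w fun k _ ↦
    hasGradientAt_integral_componentDensity_mul hS a hc (μ k) z hp hp0 hpB
  simp_rw [densityZtY, integral_jointDensity]
  convert hgrad using 1
  rw [hibp, map_sum, ← Finset.sum_add_distrib]
  refine Finset.sum_congr rfl fun k _ ↦ ?_
  rw [map_smul, ← ContinuousLinearMap.integral_comp_comm _ (hsc k), mul_smul, ← smul_add,
    ← integral_smul_const, ← integral_add ((hqi k).smul_const _)
      ((act (jacobianJ S a c)).integrable_comp (hsc k))]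
  -- All integrals of component `k` are now merged, so only the pointwise identity of
  -- `act_jacobianJ_score` is left.
  congr 2
  ext1 x
  rw [map_smul, map_smul, act_jacobianJ_score hS a hc]
  module

/-- Logarithmic differentiation: the factor `p_Y(y)` does not depend on `z` and cancels, and
division by `p_{Z_t,Y}(z, y)` turns the integrals into posterior weights and a conditional
expectation. -/
theorem hasGradientAt_log_condDensityZt (hS : S.PosDef) (hc : 0 < c) (hM : Differentiable ℝ M)
    (hSobs : Sobs.PosDef) (hw : ∀ k, 0 ≤ w k) (hw_sum : ∑ k, w k = 1)
    (z : EuclideanSpace ℝ (Fin d)) (y : EuclideanSpace ℝ (Fin r))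
    (hint : Integrable (fun z₀ ↦ condDensityZ0 (jointDensity w μ S a c M Sobs) z₀ z y •
      likelihoodScore M Sobs y z₀)) :
    HasGradientAt (fun z' ↦ Real.log (condDensityZt (jointDensity w μ S a c M Sobs) z' y))
      (∑ k, posteriorWeight (jointDensity w μ S a c M Sobs) k z y • componentScore S a c (μ k) z +
        act (jacobianJ S a c) (condExpectation (jointDensity w μ S a c M Sobs)
          (likelihoodScore M Sobs y) z y)) z := by
  have hD := densityZtY_jointDensity_pos (a := a) (μ := μ) hS hc hM.continuous hSobs hw hw_sum z y
  have hY := densityY_jointDensity_pos (a := a) (μ := μ) hS hc hM.continuous hSobs hw hw_sum y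
  have hcond : ∀ x, condDensityZ0 (jointDensity w μ S a c M Sobs) x z y •
      likelihoodScore M Sobs y x = (densityZtY (jointDensity w μ S a c M Sobs) z y)⁻¹ •
        (∑ k, jointDensity w μ S a c M Sobs k x z y) • likelihoodScore M Sobs y x := fun x ↦ by
    rw [condDensityZ0, div_eq_inv_mul, mul_smul]
  simp_rw [hcond] at hint
  rw [integrable_fun_smul_iff (inv_ne_zero hD.ne')] at hint
  have hgrad := hasGradientAt_densityZtY hS hc hM hSobs z y hint
  rw [hasGradientAt_iff_hasFDerivAt_innerSL] at hgrad ⊢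
  simp_rw [condDensityZt, div_eq_mul_inv]
  refine ((hgrad.mul_const _).log (mul_pos hD (inv_pos.2 hY)).ne').congr_fderiv ?_
  rw [← map_smul, ← map_smul]
  congr 1
  simp_rw [condExpectation, hcond, integral_smul, posteriorWeight, div_eq_inv_mul, mul_smul]
  rw [map_smul, ← Finset.smul_sum, ← smul_add, smul_smul]
  congr 1
  field_simp

end ScoreFormula

/-! ### The joint density of `(ξ, Z_0, Z_t, Y)` -/

section JointLaw

variable {d r K : ℕ}

lemma measurable_gaussDensity {α : Type*} [MeasurableSpace α] {S : Matrix (Fin d) (Fin d) ℝ}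
    {u v : α → EuclideanSpace ℝ (Fin d)} (hu : Measurable u) (hv : Measurable v) :
    Measurable (fun p ↦ gaussDensity (u p) S (v p)) := by
  unfold gaussDensity
  fun_prop

/-- The change of variables `((k, x), e), g ↦ (k, x, a x + g, M x + e)` preserves the reference
measure. -/
lemma map_shear_prod (a : ℝ) {M : EuclideanSpace ℝ (Fin d) → EuclideanSpace ℝ (Fin r)}
    (hM : Measurable M) :
    ((((Measure.count : Measure (Fin K)).prod
        (volume : Measure (EuclideanSpace ℝ (Fin d)))).prod
          (volume : Measure (EuclideanSpace ℝ (Fin r)))).prod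
            (volume : Measure (EuclideanSpace ℝ (Fin d)))).map
      (fun q ↦ (q.1.1.1, q.1.1.2, a • q.1.1.2 + q.2, M q.1.1.2 + q.1.2)) =
    Measure.count.prod (volume.prod (volume.prod volume)) := by
  refine Measure.ext_of_lintegral _ fun F hF ↦ ?_
  have hm : Measurable (fun q : ((Fin K × EuclideanSpace ℝ (Fin d)) × EuclideanSpace ℝ (Fin r)) ×
      EuclideanSpace ℝ (Fin d) ↦
      (q.1.1.1, q.1.1.2, a • q.1.1.2 + q.2, M q.1.1.2 + q.1.2)) := by fun_prop
  have hFm : Measurable (fun q : ((Fin K × EuclideanSpace ℝ (Fin d)) × EuclideanSpace ℝ (Fin r)) ×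
      EuclideanSpace ℝ (Fin d) ↦
      F (q.1.1.1, q.1.1.2, a • q.1.1.2 + q.2, M q.1.1.2 + q.1.2)) := hF.comp hm
  rw [lintegral_map hF hm, lintegral_prod _ hFm.aemeasurable,
    lintegral_prod _ hFm.lintegral_prod_right'.aemeasurable,
    lintegral_prod _ hFm.lintegral_prod_right'.lintegral_prod_right'.aemeasurable,
    lintegral_prod _ hF.aemeasurable]
  congr 1
  ext1 k
  have hFk : Measurable fun y ↦ F (k, y) := hF.comp measurable_prodMk_left
  rw [lintegral_prod _ hFk.aemeasurable]
  congr 1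
  ext1 x
  have hFx : Measurable fun y ↦ F (k, x, y) := hFk.comp measurable_prodMk_left
  -- The source integrates `g` inside `e`, while the target lists `g` first. After the exchange,
  -- translation invariance in each variable removes the shifts `M x` and `a • x`.
  rw [lintegral_prod_symm _ hFx.aemeasurable]
  refine Eq.trans ?_ (lintegral_add_left_eq_self (μ := volume) (fun e ↦ ∫⁻ g, F (k, x, g, e)) (M x))
  congr 1
  ext1 e
  exact lintegral_add_left_eq_self (μ := volume) (fun g ↦ F (k, x, g, M x + e)) (a • x)

/-- By independence, `((ξ, Z₀), ε, G)` has a product density. The shear preserves the reference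
measure, and the centred densities of `G` and `ε` become the transition density and the likelihood.
-/
theorem hasLaw_jointDensity {Ω : Type*} [MeasurableSpace Ω] {P : Measure Ω}
    [IsProbabilityMeasure P] {w : Fin K → ℝ} (hw : ∀ k, 0 ≤ w k)
    {μ : Fin K → EuclideanSpace ℝ (Fin d)} {S : Matrix (Fin d) (Fin d) ℝ} (hS : S.PosDef)
    {M : EuclideanSpace ℝ (Fin d) → EuclideanSpace ℝ (Fin r)} (hM : Measurable M)
    {Sobs : Matrix (Fin r) (Fin r) ℝ} (hSobs : Sobs.PosDef) {a c : ℝ} (hc : 0 < c)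
    {ξ : Ω → Fin K} {Z₀ G : Ω → EuclideanSpace ℝ (Fin d)} {ε : Ω → EuclideanSpace ℝ (Fin r)}
    (hprior : HasLaw (fun ω ↦ (ξ ω, Z₀ ω))
      ((Measure.count.prod volume).withDensity
        (fun p ↦ ENNReal.ofReal (w p.1 * gaussDensity (μ p.1) S p.2))) P)
    (hε : HasLaw ε (multivariateGaussian 0 Sobs) P)
    (hG : HasLaw G (multivariateGaussian 0 (c ^ 2 • (1 : Matrix (Fin d) (Fin d) ℝ))) P)
    (hind_ε : IndepFun ε (fun ω ↦ (ξ ω, Z₀ ω)) P)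
    (hind_G : IndepFun G (fun ω ↦ ((ξ ω, Z₀ ω), ε ω)) P) :
    HasLaw (fun ω ↦ (ξ ω, Z₀ ω, a • Z₀ ω + G ω, M (Z₀ ω) + ε ω))
      ((Measure.count.prod (volume.prod (volume.prod volume))).withDensity
        (fun p ↦ ENNReal.ofReal
          (jointDensity w μ S a c M Sobs p.1 p.2.1 p.2.2.1 p.2.2.2))) P := by
  have hC := posDef_sq_smul_one (d := d) hc
  have hwm : Measurable w := Measurable.of_discrete
  have hμm : Measurable μ := Measurable.of_discrete
  have h1 := (indepFun_iff_hasLaw_prodMk_prod hprior hε).1 hind_ε.symm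
  have h2 := (indepFun_iff_hasLaw_prodMk_prod h1 hG).1 hind_G.symm
  have hm1 : Measurable fun p : Fin K × EuclideanSpace ℝ (Fin d) ↦
      ENNReal.ofReal (w p.1 * gaussDensity (μ p.1) S p.2) :=
    ((hwm.comp measurable_fst).mul (measurable_gaussDensity (by fun_prop) (by fun_prop))).ennreal_ofReal
  have hm2 : Measurable fun e ↦ ENNReal.ofReal (gaussDensity 0 Sobs e) :=
    (measurable_gaussDensity measurable_const measurable_id).ennreal_ofReal
  have hm3 : Measurable fun g ↦ ENNReal.ofReal
      (gaussDensity 0 (c ^ 2 • (1 : Matrix (Fin d) (Fin d) ℝ)) g) :=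
    (measurable_gaussDensity measurable_const measurable_id).ennreal_ofReal
  have hm4 : Measurable fun z : (Fin K × EuclideanSpace ℝ (Fin d)) × EuclideanSpace ℝ (Fin r) ↦
      ENNReal.ofReal (w z.1.1 * gaussDensity (μ z.1.1) S z.1.2) *
        ENNReal.ofReal (gaussDensity 0 Sobs z.2) :=
    (hm1.comp measurable_fst).mul (hm2.comp measurable_snd)
  rw [multivariateGaussian_eq_withDensity _ hSobs, multivariateGaussian_eq_withDensity _ hC,
    prod_withDensity hm1 hm2, prod_withDensity hm4 hm3] at h2
  have hΦ : Measurable (fun q : ((Fin K × EuclideanSpace ℝ (Fin d)) × EuclideanSpace ℝ (Fin r)) ×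
      EuclideanSpace ℝ (Fin d) ↦
      (q.1.1.1, q.1.1.2, a • q.1.1.2 + q.2, M q.1.1.2 + q.1.2)) := by fun_prop
  have hJ : Measurable (fun p : Fin K × EuclideanSpace ℝ (Fin d) × EuclideanSpace ℝ (Fin d) ×
      EuclideanSpace ℝ (Fin r) ↦ ENNReal.ofReal
          (jointDensity w μ S a c M Sobs p.1 p.2.1 p.2.2.1 p.2.2.2)) := by
    unfold jointDensity componentDensity likelihood
    refine Measurable.ennreal_ofReal (((hwm.comp measurable_fst).mul (.mul ?_ ?_)).mul ?_) <;>
      exact measurable_gaussDensity (by fun_prop) (by fun_prop)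
  have h3 : HasLaw (fun q : ((Fin K × EuclideanSpace ℝ (Fin d)) × EuclideanSpace ℝ (Fin r)) ×
      EuclideanSpace ℝ (Fin d) ↦ (q.1.1.1, q.1.1.2, a • q.1.1.2 + q.2, M q.1.1.2 + q.1.2))
      ((Measure.count.prod (volume.prod (volume.prod volume))).withDensity
        (fun p ↦ ENNReal.ofReal
          (jointDensity w μ S a c M Sobs p.1 p.2.1 p.2.2.1 p.2.2.2)))
      (((((Measure.count : Measure (Fin K)).prod volume).prod volume).prod volume).withDensity
        (fun q ↦ ENNReal.ofReal (w q.1.1.1 * gaussDensity (μ q.1.1.1) S q.1.1.2) *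
          ENNReal.ofReal (gaussDensity 0 Sobs q.1.2) *
          ENNReal.ofReal (gaussDensity 0 (c ^ 2 • 1) q.2))) := by
    refine ⟨hΦ.aemeasurable, ?_⟩
    rw [← map_shear_prod a hM, ← map_withDensity_comp _ hΦ hJ]
    congr 2
    ext1 q
    have hw' := hw q.1.1.1
    have hg := (gaussDensity_pos (μ q.1.1.1) hS q.1.1.2).le
    have he := (gaussDensity_pos 0 hSobs q.1.2).le
    simp only [Function.comp_apply]
    rw [← ENNReal.ofReal_mul (by positivity), ← ENNReal.ofReal_mul (by positivity)]
    simp only [jointDensity, componentDensity, likelihood, gaussDensity, add_sub_cancel_left,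
      sub_zero]
    ring_nf
  exact h3.comp h2

end JointLaw

/-! ### Gaussian law and independence through characteristic functions -/

section Independence

open scoped Topology

variable {Ω 𝓨 : Type*} [MeasurableSpace Ω] [MeasurableSpace 𝓨] {P : Measure Ω} {d : ℕ}

/-- `X` is independent of `η` and centred isotropic Gaussian with variance `v`, expressed through
the characteristic functions of `X` on the events of `η`. -/
def IsIndepGaussian (P : Measure Ω) (η : Ω → 𝓨) (X : Ω → EuclideanSpace ℝ (Fin d)) (v : ℝ) : Prop :=
  ∀ B, MeasurableSet B → ∀ θ, ∫ ω in η ⁻¹' B, Complex.exp (inner ℝ (X ω) θ * Complex.I) ∂P =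
    P.real (η ⁻¹' B) * Complex.exp (-(v * ‖θ‖ ^ 2 / 2 : ℝ))

/-- A subsequence converges almost surely and the exponentials have modulus one, so dominated
convergence applies on each event of `η`. -/
lemma IsIndepGaussian.of_tendstoInMeasure [IsFiniteMeasure P] {η : Ω → 𝓨}
    {X : ℕ → Ω → EuclideanSpace ℝ (Fin d)} {X' : Ω → EuclideanSpace ℝ (Fin d)} {v : ℕ → ℝ} {v' : ℝ}
    (hm : ∀ n, AEMeasurable (X n) P) (h : ∀ n, IsIndepGaussian P η (X n) (v n))
    (hX : TendstoInMeasure P X atTop X') (hv : Tendsto v atTop (𝓝 v')) :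
    IsIndepGaussian P η X' v' := by
  intro B hB θ
  obtain ⟨ns, hns, hlim⟩ := hX.exists_seq_tendsto_ae
  have h1 : Tendsto (fun n ↦ ∫ ω in η ⁻¹' B,
      Complex.exp (inner ℝ (X (ns n) ω) θ * Complex.I) ∂P) atTop
      (𝓝 (∫ ω in η ⁻¹' B, Complex.exp (inner ℝ (X' ω) θ * Complex.I) ∂P)) := by
    refine tendsto_integral_of_dominated_convergence (fun _ ↦ (1 : ℝ)) (fun n ↦ ?_)
      (integrable_const _) (fun n ↦ ae_of_all _ fun ω ↦ (Complex.norm_exp_ofReal_mul_I _).le) ?_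
    · have hmn := (hm (ns n)).restrict (s := η ⁻¹' B)
      have hc : Continuous fun x : EuclideanSpace ℝ (Fin d) ↦
        Complex.exp (inner ℝ x θ * Complex.I) := by fun_prop
      exact (hc.measurable.comp_aemeasurable hmn).aestronglyMeasurable
    · filter_upwards [ae_restrict_of_ae hlim] with ω hω
      have hc : Continuous fun x : EuclideanSpace ℝ (Fin d) ↦
        Complex.exp (inner ℝ x θ * Complex.I) := by fun_prop
      exact (hc.tendsto _).comp hω
  have h2 : Tendsto (fun n ↦ (P.real (η ⁻¹' B) *
      Complex.exp (-(v (ns n) * ‖θ‖ ^ 2 / 2 : ℝ)) : ℂ)) atTop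
      (𝓝 (P.real (η ⁻¹' B) * Complex.exp (-(v' * ‖θ‖ ^ 2 / 2 : ℝ)))) := by
    have hc : Continuous fun x : ℝ ↦
      (P.real (η ⁻¹' B) * Complex.exp (-(x * ‖θ‖ ^ 2 / 2 : ℝ)) : ℂ) := by fun_prop
    exact (hc.tendsto _).comp (hv.comp hns.tendsto_atTop)
  exact tendsto_nhds_unique h1 (h2.congr fun n ↦ (h (ns n) B hB θ).symm)

lemma charFun_multivariateGaussian_smul_one {c : ℝ} (θ : EuclideanSpace ℝ (Fin d)) :
    charFun (multivariateGaussian 0 (c ^ 2 • (1 : Matrix (Fin d) (Fin d) ℝ))) θ =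
      Complex.exp (-(c ^ 2 * ‖θ‖ ^ 2 / 2 : ℝ)) := by
  rw [charFun_multivariateGaussian (Matrix.PosSemidef.one.smul (sq_nonneg c))]
  congr 1
  rw [Matrix.smul_mulVec, Matrix.one_mulVec, dotProduct_smul, EuclideanSpace.real_norm_sq_eq]
  simp [dotProduct, pow_two]

/-- Finite measures are determined by their characteristic functions. Taking `B` to be everything
gives the law of `X`; general `B` then gives independence. -/
lemma IsIndepGaussian.map_restrict_eq [IsProbabilityMeasure P] {η : Ω → 𝓨}
    {X : Ω → EuclideanSpace ℝ (Fin d)} {c : ℝ} (hX : AEMeasurable X P)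
    (h : IsIndepGaussian P η X (c ^ 2)) {B : Set 𝓨} (hB : MeasurableSet B) :
    (P.restrict (η ⁻¹' B)).map X =
      P (η ⁻¹' B) • multivariateGaussian 0 (c ^ 2 • (1 : Matrix (Fin d) (Fin d) ℝ)) := by
  have : IsFiniteMeasure (P (η ⁻¹' B) •
      multivariateGaussian 0 (c ^ 2 • (1 : Matrix (Fin d) (Fin d) ℝ))) :=
    Measure.smul_finite _ (measure_ne_top _ _)
  refine Measure.ext_of_charFun (funext fun θ ↦ ?_)
  rw [charFun_apply, integral_map hX.restrict (by fun_prop), h B hB θ,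
    charFun_apply, integral_smul_measure, ← charFun_apply, charFun_multivariateGaussian_smul_one,
    Complex.real_smul]
  rfl

lemma IsIndepGaussian.hasLaw [IsProbabilityMeasure P] {η : Ω → 𝓨}
    {X : Ω → EuclideanSpace ℝ (Fin d)} {c : ℝ} (hX : AEMeasurable X P)
    (h : IsIndepGaussian P η X (c ^ 2)) :
    HasLaw X (multivariateGaussian 0 (c ^ 2 • (1 : Matrix (Fin d) (Fin d) ℝ))) P where
  aemeasurable := hX
  map_eq := by simpa using h.map_restrict_eq hX MeasurableSet.univ

lemma IsIndepGaussian.indepFun [IsProbabilityMeasure P] {η : Ω → 𝓨} (hη : AEMeasurable η P)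
    {X : Ω → EuclideanSpace ℝ (Fin d)} {c : ℝ} (hX : AEMeasurable X P)
    (h : IsIndepGaussian P η X (c ^ 2)) : IndepFun X η P := by
  rw [indepFun_iff_measure_inter_preimage_eq_mul]
  intro s B hs hB
  have h1 := congrArg (fun ν ↦ ν s) (h.map_restrict_eq hX hB)
  simp only [Measure.smul_apply, smul_eq_mul] at h1
  rw [Measure.map_apply_of_aemeasurable hX.restrict hs,
    Measure.restrict_apply₀' (hη.nullMeasurableSet_preimage hB)] at h1
  rw [h1, mul_comm, ← (h.hasLaw hX).map_eq, Measure.map_apply_of_aemeasurable hX hs]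

lemma IsIndepGaussian.of_indepFun [IsFiniteMeasure P] {η : Ω → 𝓨} (hη : AEMeasurable η P)
    {X : Ω → EuclideanSpace ℝ (Fin d)} {v : ℝ} (hX : AEMeasurable X P) (hind : IndepFun X η P)
    (hchar : ∀ θ, charFun (P.map X) θ = Complex.exp (-(v * ‖θ‖ ^ 2 / 2 : ℝ))) :
    IsIndepGaussian P η X v := by
  intro B hB θ
  have hmap : (P.restrict (η ⁻¹' B)).map X = P (η ⁻¹' B) • P.map X := by
    ext s hs
    rw [Measure.map_apply_of_aemeasurable hX.restrict hs,
      Measure.restrict_apply₀' (hη.nullMeasurableSet_preimage hB), Measure.smul_apply, smul_eq_mul,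
      Measure.map_apply_of_aemeasurable hX hs, mul_comm]
    exact hind.measure_inter_preimage_eq_mul s B hs hB
  rw [← integral_map (f := fun x ↦ Complex.exp (inner ℝ x θ * Complex.I)) hX.restrict (by fun_prop),
    hmap, integral_smul_measure, ← charFun_apply, hchar, Complex.real_smul]
  rfl

end Independence

/-! ### Wiener integrals of step functions -/

section WienerSum

variable {Ω : Type*} [MeasurableSpace Ω] {P : Measure Ω} {d : ℕ}
  {W : ℝ≥0 → Ω → EuclideanSpace ℝ (Fin d)}

/-- The linear combination `∑ c(t) W_t`. -/
noncomputable def wienerSum (W : ℝ≥0 → Ω → EuclideanSpace ℝ (Fin d)) (c : ℝ≥0 →₀ ℝ) (ω : Ω) :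
    EuclideanSpace ℝ (Fin d) :=
  c.sum fun t r ↦ r • W t ω

/-- The integrand `∑ c(t) 1_{[0, t)}` whose Wiener integral is `wienerSum W c`. -/
noncomputable def stepFun (c : ℝ≥0 →₀ ℝ) (u : ℝ) : ℝ :=
  c.sum fun t r ↦ r * (Ico (0 : ℝ) t).indicator 1 u

lemma measurable_stepFun (c : ℝ≥0 →₀ ℝ) : Measurable (stepFun c) := by
  unfold stepFun Finsupp.sum
  exact Finset.measurable_sum _ fun t _ ↦
    (measurable_const.mul (measurable_one.indicator measurableSet_Ico))

/-- The indicators of `[0, s)` and `[0, t)` have inner product `min s t`, the Brownian covariance: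
this is the Itô isometry for step functions. -/
lemma integral_stepFun_sq (c : ℝ≥0 →₀ ℝ) :
    ∫ u, stepFun c u ^ 2 = ∑ s ∈ c.support, ∑ t ∈ c.support, c s * c t * min s t := by
  have hI : ∀ s t : ℝ≥0, ∀ u, (Ico (0 : ℝ) s).indicator (1 : ℝ → ℝ) u *
      (Ico (0 : ℝ) t).indicator (1 : ℝ → ℝ) u =
      (Ico (0 : ℝ) (min s t : ℝ≥0)).indicator (1 : ℝ → ℝ) u := fun s t u ↦ by
    simp only [indicator_apply, mem_Ico, NNReal.coe_min, lt_min_iff, Pi.one_apply]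
    split_ifs <;> grind
  have hint : ∀ s : ℝ≥0, Integrable ((Ico (0 : ℝ) s).indicator (1 : ℝ → ℝ)) := fun s ↦
    (integrable_indicator_iff measurableSet_Ico).2 (integrableOn_const (by simp))
  have hexp : ∀ u, stepFun c u ^ 2 = ∑ s ∈ c.support, ∑ t ∈ c.support,
      c s * c t * (Ico (0 : ℝ) (min s t : ℝ≥0)).indicator (1 : ℝ → ℝ) u := fun u ↦ by
    rw [stepFun, Finsupp.sum, pow_two, Finset.sum_mul_sum]
    simp_rw [← hI]
    exact Finset.sum_congr rfl fun s _ ↦ Finset.sum_congr rfl fun t _ ↦ by ring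
  simp_rw [hexp]
  rw [integral_finsetSum _ fun s _ ↦ integrable_finsetSum _ fun t _ ↦ (hint _).const_mul _]
  refine Finset.sum_congr rfl fun s _ ↦ ?_
  rw [integral_finsetSum _ fun t _ ↦ (hint _).const_mul _]
  refine Finset.sum_congr rfl fun t _ ↦ ?_
  rw [integral_const_mul, integral_indicator_one measurableSet_Ico]
  simp

lemma IsStdBrownian.aemeasurable (hW : IsStdBrownian W P) (t : ℝ≥0) : AEMeasurable (W t) P := by
  have h : AEMeasurable (fun ω i ↦ W t ω i) P :=
    aemeasurable_pi_lambda _ fun i ↦ (hW.coord i).aemeasurable t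
  exact (PiLp.continuous_toLp 2 _).measurable.comp_aemeasurable h

lemma IsStdBrownian.aemeasurable_wienerSum (hW : IsStdBrownian W P) (c : ℝ≥0 →₀ ℝ) :
    AEMeasurable (wienerSum W c) P := by
  unfold wienerSum Finsupp.sum
  exact Finset.aemeasurable_fun_sum _ fun t _ ↦ (hW.aemeasurable t).const_smul (c t)

lemma charFun_map_sum_mul_of_isPreBrownianReal [IsProbabilityMeasure P] {B : ℝ≥0 → Ω → ℝ}
    (hB : IsPreBrownianReal B P) (c : ℝ≥0 →₀ ℝ) (x : ℝ) :
    charFun (P.map fun ω ↦ c.sum fun t r ↦ r * B t ω) x =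
      Complex.exp (-((∫ u, stepFun c u ^ 2) * x ^ 2 / 2 : ℝ)) := by
  have hg : HasGaussianLaw (fun ω ↦ ∑ t ∈ c.support, c t * B t ω) P :=
    (hB.isGaussianProcess.smul c).hasGaussianLaw_fun_sum
  have hL2 : ∀ t, MemLp (fun ω ↦ c t * B t ω) 2 P := fun t ↦
    (hB.isGaussianProcess.hasGaussianLaw_eval t).memLp_two.const_mul (c t)
  have hmean : ∫ ω, ∑ t ∈ c.support, c t * B t ω ∂P = 0 := by
    rw [integral_finsetSum _ fun t _ ↦ (hB.integrable_eval t).const_mul _]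
    exact Finset.sum_eq_zero fun t _ ↦ by rw [integral_const_mul, hB.integral_eval, mul_zero]
  have hvar : Var[fun ω ↦ ∑ t ∈ c.support, c t * B t ω; P] = ∫ u, stepFun c u ^ 2 := by
    rw [← covariance_self hg.aemeasurable,
      covariance_fun_sum_fun_sum' (fun t _ ↦ hL2 t) (fun t _ ↦ hL2 t), integral_stepFun_sq]
    refine Finset.sum_congr rfl fun s _ ↦ Finset.sum_congr rfl fun t _ ↦ ?_
    rw [covariance_const_mul_left, covariance_const_mul_right, hB.covariance_fun_eval]
    push_cast
    ring
  change charFun (P.map fun ω ↦ ∑ t ∈ c.support, c t * B t ω) x = _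
  rw [hg.map_eq_gaussianReal, hmean, hvar, charFun_gaussianReal,
    Real.coe_toNNReal _ (integral_nonneg fun u ↦ sq_nonneg _)]
  congr 1
  push_cast
  ring

/-- The coordinates are independent with the same variance, so their characteristic functions
multiply and the squares `θ_i²` add up to `‖θ‖²`. -/
lemma IsStdBrownian.charFun_wienerSum [IsProbabilityMeasure P] (hW : IsStdBrownian W P)
    (c : ℝ≥0 →₀ ℝ) (θ : EuclideanSpace ℝ (Fin d)) :
    charFun (P.map (wienerSum W c)) θ =
      Complex.exp (-((∫ u, stepFun c u ^ 2) * ‖θ‖ ^ 2 / 2 : ℝ)) := by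
  have hind : iIndepFun (fun (i : Fin d) ω ↦ c.sum fun t r ↦ r * W t ω i) P :=
    hW.indep.comp (fun _ path ↦ c.sum fun t r ↦ r * path t) fun _ ↦ by
      unfold Finsupp.sum
      fun_prop
  have hm : ∀ i, AEMeasurable (fun ω ↦ c.sum fun t r ↦ r * W t ω i) P := fun i ↦ by
    unfold Finsupp.sum
    exact Finset.aemeasurable_fun_sum _ fun t _ ↦ ((hW.coord i).aemeasurable t).const_mul _
  have heq : wienerSum W c = fun ω ↦ WithLp.toLp 2 fun i ↦ c.sum fun t r ↦ r * W t ω i := by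
    ext ω i
    simp [wienerSum, Finsupp.sum]
  rw [heq, (iIndepFun_iff_charFun_pi hm).1 hind θ]
  simp_rw [charFun_map_sum_mul_of_isPreBrownianReal (hW.coord _).toIsPreBrownianReal]
  rw [← Complex.exp_sum, EuclideanSpace.real_norm_sq_eq]
  congr 1
  push_cast
  rw [Finset.sum_neg_distrib, ← Finset.sum_div, ← Finset.mul_sum]

lemma IsStdBrownian.isIndepGaussian_wienerSum [IsProbabilityMeasure P] (hW : IsStdBrownian W P)
    {𝓨 : Type*} [MeasurableSpace 𝓨] {η : Ω → 𝓨} (hη : AEMeasurable η P)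
    (hind : IndepFun (fun ω (s : ℝ≥0) ↦ W s ω) η P) (c : ℝ≥0 →₀ ℝ) :
    IsIndepGaussian P η (wienerSum W c) (∫ u, stepFun c u ^ 2) := by
  refine .of_indepFun hη (hW.aemeasurable_wienerSum c) ?_ (hW.charFun_wienerSum c)
  refine hind.comp (φ := fun path : ℝ≥0 → EuclideanSpace ℝ (Fin d) ↦ c.sum fun t r ↦ r • path t)
    (ψ := id) ?_ measurable_id
  unfold Finsupp.sum
  fun_prop

end WienerSum

/-! ### Left Riemann sums along uniform partitions -/

section Riemann

open scoped Topology

/-- The left end point, in the uniform partition of `[0, t]` into `n` intervals, of the interval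
that contains `u`. -/
noncomputable def leftPoint (t : ℝ) (n : ℕ) (u : ℝ) : ℝ := ⌊u * n / t⌋ * t / n

lemma leftPoint_eq {t : ℝ} (ht : 0 < t) {n i : ℕ} (hn : 0 < n) {u : ℝ}
    (hu : u ∈ Ico (i * t / n) ((i + 1) * t / n)) : leftPoint t n u = i * t / n := by
  have hn' : (0 : ℝ) < n := Nat.cast_pos.2 hn
  have h : ⌊u * n / t⌋ = (i : ℤ) := by
    rw [Int.floor_eq_iff]
    constructor
    · rw [le_div_iff₀ ht]
      exact_mod_cast (div_le_iff₀ hn').1 hu.1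
    · rw [div_lt_iff₀ ht]
      exact_mod_cast (lt_div_iff₀ hn').1 hu.2
  rw [leftPoint, h, Int.cast_natCast]

lemma leftPoint_mem {t : ℝ} (ht : 0 < t) {n : ℕ} (hn : 0 < n) {u : ℝ} (hu : 0 ≤ u) :
    leftPoint t n u ∈ Icc 0 u := by
  have hn' : (0 : ℝ) < n := Nat.cast_pos.2 hn
  have h0 : (0 : ℝ) ≤ ⌊u * n / t⌋ := by exact_mod_cast Int.floor_nonneg.2 (by positivity)
  refine ⟨by unfold leftPoint; positivity, ?_⟩
  rw [leftPoint, div_le_iff₀ hn', ← le_div_iff₀ ht]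
  exact Int.floor_le _

lemma tendsto_leftPoint {t : ℝ} (ht : 0 < t) {u : ℝ} (hu : 0 ≤ u) :
    Tendsto (fun n ↦ leftPoint t n u) atTop (𝓝 u) := by
  have h1 : Tendsto (fun n : ℕ ↦ u - t / n) atTop (𝓝 (u - 0)) :=
    tendsto_const_nhds.sub (tendsto_const_div_atTop_nhds_zero_nat t)
  rw [sub_zero] at h1
  refine tendsto_of_tendsto_of_tendsto_of_le_of_le' h1 tendsto_const_nhds ?_ ?_
  · filter_upwards [eventually_gt_atTop 0] with n hn
    have hn' : (0 : ℝ) < n := Nat.cast_pos.2 hn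
    have h2 := (Int.sub_one_lt_floor (u * n / t)).le
    calc u - t / n = (u * n / t - 1) * t / n := by field_simp
      _ ≤ leftPoint t n u := by unfold leftPoint; gcongr
  · filter_upwards [eventually_gt_atTop 0] with n hn using (leftPoint_mem ht hn hu).2

/-- The composition factors through the integer `⌊u n / t⌋`, so `g` may be arbitrary. -/
lemma stronglyMeasurable_comp_leftPoint {F : Type*} [TopologicalSpace F] (g : ℝ → F) (t : ℝ)
    (n : ℕ) : StronglyMeasurable (fun u ↦ g (leftPoint t n u)) := by
  have h : StronglyMeasurable fun z : ℤ ↦ g (z * t / n) := StronglyMeasurable.of_discrete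
  exact h.comp_measurable (Int.measurable_floor.comp (by fun_prop : Measurable fun u : ℝ ↦ u * n / t))

/-- Left Riemann sums along uniform partitions converge for bounded, almost everywhere continuous
functions. -/
lemma tendsto_riemannSum {F : Type*} [NormedAddCommGroup F] [NormedSpace ℝ F] [CompleteSpace F]
    {g : ℝ → F} {t C : ℝ} (ht : 0 < t) (hC : ∀ u ∈ Ico 0 t, ‖g u‖ ≤ C)
    (hg : ∀ᵐ u, u ∈ Ico 0 t → ContinuousWithinAt g (Ico 0 t) u) :
    Tendsto (fun n : ℕ ↦ ∑ i ∈ Finset.range n, (t / n) • g (i * t / n)) atTop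
      (𝓝 (∫ u in (0 : ℝ)..t, g u)) := by
  have hmem : ∀ {n : ℕ}, 0 < n → ∀ {u}, u ∈ Ico 0 t → leftPoint t n u ∈ Ico 0 t :=
    fun hn u hu ↦ ⟨(leftPoint_mem ht hn hu.1).1, (leftPoint_mem ht hn hu.1).2.trans_lt hu.2⟩
  -- The Riemann sum is exactly the integral of the step function `g ∘ leftPoint`, so its limit is a
  -- matter of dominated convergence.
  have hsum : ∀ n : ℕ, 0 < n → ∫ u in (0 : ℝ)..t, g (leftPoint t n u) =
      ∑ i ∈ Finset.range n, (t / n) • g (i * t / n) := fun n hn ↦ by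
    have hn' : (0 : ℝ) < n := Nat.cast_pos.2 hn
    have hle : ∀ i : ℕ, (i : ℝ) * t / n ≤ ((i + 1 : ℕ) : ℝ) * t / n := fun i ↦ by
      push_cast
      gcongr
      linarith
    have hae : ∀ i : ℕ, (fun u ↦ g (leftPoint t n u)) =ᵐ[volume.restrict
        (Ioc ((i : ℝ) * t / n) (((i + 1 : ℕ) : ℝ) * t / n))] fun _ ↦ g (i * t / n) := fun i ↦ by
      rw [← restrict_Ico_eq_restrict_Ioc]
      refine (ae_restrict_iff' measurableSet_Ico).2 (ae_of_all _ fun u hu ↦ ?_)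
      simp only
      rw [leftPoint_eq ht hn (by exact_mod_cast hu)]
    have h := intervalIntegral.sum_integral_adjacent_intervals (μ := volume)
      (f := fun u ↦ g (leftPoint t n u)) (a := fun i : ℕ ↦ (i : ℝ) * t / n) (n := n) fun i _ ↦ by
        rw [intervalIntegrable_iff_integrableOn_Ioc_of_le (hle i)]
        exact (integrableOn_const (by simp)).congr (hae i).symm
    simp only [CharP.cast_eq_zero, zero_mul, zero_div] at h
    rw [mul_div_cancel_left₀ _ hn'.ne'] at h
    rw [← h]
    refine Finset.sum_congr rfl fun i _ ↦ ?_
    rw [intervalIntegral.integral_of_le (hle i), integral_congr_ae (hae i), integral_const,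
      measureReal_restrict_apply_univ, Real.volume_real_Ioc_of_le (hle i)]
    congr 1
    push_cast
    ring
  refine Tendsto.congr' (f₁ := fun n : ℕ ↦ ∫ u in (0 : ℝ)..t, g (leftPoint t n u))
    (by filter_upwards [eventually_gt_atTop 0] with n hn using hsum n hn) ?_
  simp_rw [intervalIntegral.integral_of_le ht.le, ← integral_Ico_eq_integral_Ioc]
  refine tendsto_integral_filter_of_dominated_convergence (fun _ ↦ C)
    (Eventually.of_forall fun n ↦ (stronglyMeasurable_comp_leftPoint g t n).aestronglyMeasurable)
    ?_ (integrable_const _) ?_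
  · filter_upwards [eventually_gt_atTop 0] with n hn
    exact (ae_restrict_iff' measurableSet_Ico).2 (ae_of_all _ fun u hu ↦ hC _ (hmem hn hu))
  · refine (ae_restrict_iff' measurableSet_Ico).2 ?_
    filter_upwards [hg] with u hgu hu
    refine Tendsto.comp (hgu hu) (tendsto_nhdsWithin_iff.2 ⟨tendsto_leftPoint ht hu.1, ?_⟩)
    filter_upwards [eventually_gt_atTop 0] with n hn using hmem hn hu

end Riemann

/-! ### Wiener integrals as limits of step-function integrals -/

section WienerLimit

open scoped Topology

lemma tendstoInMeasure_add {Ω E : Type*} [MeasurableSpace Ω] {P : Measure Ω}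
    [SeminormedAddCommGroup E] {ι : Type*} {l : Filter ι} {f g : ι → Ω → E} {f' g' : Ω → E}
    (hf : TendstoInMeasure P f l f') (hg : TendstoInMeasure P g l g') :
    TendstoInMeasure P (fun i ω ↦ f i ω + g i ω) l (fun ω ↦ f' ω + g' ω) := by
  rw [tendstoInMeasure_iff_norm] at hf hg ⊢
  intro ε hε
  have h := (hf (ε / 2) (half_pos hε)).add (hg (ε / 2) (half_pos hε))
  rw [add_zero] at h
  refine tendsto_of_tendsto_of_tendsto_of_le_of_le tendsto_const_nhds h (fun _ ↦ zero_le)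
    fun i ↦ (measure_mono fun ω hω ↦ ?_).trans (measure_union_le _ _)
  by_contra hcon
  simp only [mem_union, mem_ofPred_eq, not_or, not_le] at hcon hω
  have h1 := norm_add_le (f i ω - f' ω) (g i ω - g' ω)
  rw [sub_add_sub_comm] at h1
  linarith [hcon.1, hcon.2]

lemma tendstoInMeasure_const_smul {Ω E : Type*} [MeasurableSpace Ω] {P : Measure Ω}
    [NormedAddCommGroup E] [NormedSpace ℝ E] {ι : Type*} {l : Filter ι} {f : ι → Ω → E}
    {f' : Ω → E} (r : ℝ) (hf : TendstoInMeasure P f l f') :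
    TendstoInMeasure P (fun i ω ↦ r • f i ω) l (fun ω ↦ r • f' ω) := by
  rw [tendstoInMeasure_iff_norm] at hf ⊢
  intro ε hε
  -- Adding `1` avoids a separate case `r = 0`.
  have hr : 0 < |r| + 1 := by positivity
  refine tendsto_of_tendsto_of_tendsto_of_le_of_le tendsto_const_nhds
    (hf (ε / (|r| + 1)) (by positivity)) (fun _ ↦ zero_le) fun i ↦ measure_mono fun ω hω ↦ ?_
  simp only [mem_ofPred_eq, ← smul_sub, norm_smul, Real.norm_eq_abs] at hω ⊢
  rw [div_le_iff₀ hr]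
  nlinarith [norm_nonneg (f i ω - f' ω)]

variable {Ω : Type*} [MeasurableSpace Ω] {P : Measure Ω} {d : ℕ}
  {W : ℝ≥0 → Ω → EuclideanSpace ℝ (Fin d)}

/-- `X` is the Wiener integral of `φ`: `X` is the limit in probability of integrals of step
functions that converge boundedly to `φ`, with supports in a common bounded set. -/
def IsWienerLimit (P : Measure Ω) (W : ℝ≥0 → Ω → EuclideanSpace ℝ (Fin d))
    (X : Ω → EuclideanSpace ℝ (Fin d)) (φ : ℝ → ℝ) : Prop :=
  ∃ c : ℕ → ℝ≥0 →₀ ℝ, TendstoInMeasure P (fun n ↦ wienerSum W (c n)) atTop X ∧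
    (∀ u, Tendsto (fun n ↦ stepFun (c n) u) atTop (𝓝 (φ u))) ∧
    ∃ C A : ℝ, ∀ n u, |stepFun (c n) u| ≤ (Ico 0 A).indicator (fun _ ↦ C) u

lemma IsWienerLimit.aemeasurable (hW : IsStdBrownian W P) {X : Ω → EuclideanSpace ℝ (Fin d)}
    {φ : ℝ → ℝ} (h : IsWienerLimit P W X φ) : AEMeasurable X P := by
  obtain ⟨c, hc, -⟩ := h
  exact hc.aemeasurable fun n ↦ hW.aemeasurable_wienerSum (c n)

lemma IsWienerLimit.measurable {X : Ω → EuclideanSpace ℝ (Fin d)}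
    {φ : ℝ → ℝ} (h : IsWienerLimit P W X φ) : Measurable φ := by
  obtain ⟨c, -, hc, -⟩ := h
  exact measurable_of_tendsto_metrizable (fun n ↦ measurable_stepFun (c n)) (tendsto_pi_nhds.2 hc)

lemma tendsto_integral_sq_of_bounded {φ : ℕ → ℝ → ℝ} {φ' : ℝ → ℝ} {C A : ℝ}
    (hm : ∀ n, Measurable (φ n)) (hφ : ∀ u, Tendsto (fun n ↦ φ n u) atTop (𝓝 (φ' u)))
    (hb : ∀ n u, |φ n u| ≤ (Ico 0 A).indicator (fun _ ↦ C) u) :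
    Tendsto (fun n ↦ ∫ u, φ n u ^ 2) atTop (𝓝 (∫ u, φ' u ^ 2)) := by
  refine tendsto_integral_of_dominated_convergence ((Ico 0 A).indicator fun _ ↦ C ^ 2)
    (fun n ↦ ((hm n).pow_const 2).aestronglyMeasurable)
    ((integrable_indicator_iff measurableSet_Ico).2 (integrableOn_const (by simp)))
    (fun n ↦ ae_of_all _ fun u ↦ ?_) (ae_of_all _ fun u ↦ (hφ u).pow 2)
  have h := pow_le_pow_left₀ (abs_nonneg _) (hb n u) 2
  rw [norm_pow, Real.norm_eq_abs]
  refine h.trans (le_of_eq ?_)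
  by_cases hu : u ∈ Ico 0 A <;> simp [hu]

/-- Each approximating sum is Gaussian and independent of `η`; bounded convergence of the integrands
makes the variances converge. -/
lemma IsWienerLimit.isIndepGaussian [IsProbabilityMeasure P] (hW : IsStdBrownian W P)
    {𝓨 : Type*} [MeasurableSpace 𝓨] {η : Ω → 𝓨} (hη : AEMeasurable η P)
    (hind : IndepFun (fun ω (s : ℝ≥0) ↦ W s ω) η P) {X : Ω → EuclideanSpace ℝ (Fin d)}
    {φ : ℝ → ℝ} (h : IsWienerLimit P W X φ) : IsIndepGaussian P η X (∫ u, φ u ^ 2) := by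
  obtain ⟨c, hc, hφ, C, A, hb⟩ := h
  exact .of_tendstoInMeasure (fun n ↦ hW.aemeasurable_wienerSum (c n))
    (fun n ↦ hW.isIndepGaussian_wienerSum hη hind (c n)) hc
    (tendsto_integral_sq_of_bounded (fun n ↦ measurable_stepFun _) hφ hb)

lemma wienerSum_eq_linearCombination {Ω : Type*} (W : ℝ≥0 → Ω → EuclideanSpace ℝ (Fin d))
    (c : ℝ≥0 →₀ ℝ) (ω : Ω) :
    wienerSum W c ω = Finsupp.linearCombination ℝ (fun t ↦ W t ω) c := rfl

lemma stepFun_eq_linearCombination (c : ℝ≥0 →₀ ℝ) (u : ℝ) :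
    stepFun c u =
      Finsupp.linearCombination ℝ (fun t : ℝ≥0 ↦ (Ico (0 : ℝ) t).indicator (1 : ℝ → ℝ) u) c := rfl

lemma IsWienerLimit.zero : IsWienerLimit P W (fun _ ↦ 0) (fun _ ↦ 0) := by
  refine ⟨fun _ ↦ 0, ?_, fun u ↦ by simp [stepFun], 0, 0, fun n u ↦ by simp [stepFun]⟩
  intro ε hε
  simp [wienerSum, hε.not_ge]

lemma IsWienerLimit.add {X X' : Ω → EuclideanSpace ℝ (Fin d)} {φ φ' : ℝ → ℝ}
    (h : IsWienerLimit P W X φ) (h' : IsWienerLimit P W X' φ') :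
    IsWienerLimit P W (fun ω ↦ X ω + X' ω) (fun u ↦ φ u + φ' u) := by
  obtain ⟨c, hc, hφ, C, A, hb⟩ := h
  obtain ⟨c', hc', hφ', C', A', hb'⟩ := h'
  -- Absolute values are needed where only one of the two intervals contains `u`; a bound on an
  -- empty interval may even be negative.
  refine ⟨fun n ↦ c n + c' n, ?_, fun u ↦ ?_, |C| + |C'|, max A A', fun n u ↦ ?_⟩
  · exact (tendstoInMeasure_add hc hc').congr_left fun n ↦
      ae_of_all _ fun ω ↦ by simp only [wienerSum_eq_linearCombination, map_add]
  · simp_rw [stepFun_eq_linearCombination, map_add]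
    exact (hφ u).add (hφ' u)
  · rw [show stepFun (c n + c' n) u = stepFun (c n) u + stepFun (c' n) u by
      simp only [stepFun_eq_linearCombination, map_add]]
    have h1 := hb n u
    have h2 := hb' n u
    have h3 := abs_add_le (stepFun (c n) u) (stepFun (c' n) u)
    simp only [indicator_apply, mem_Ico, lt_max_iff] at h1 h2 ⊢
    have := abs_nonneg C
    have := abs_nonneg C'
    have := le_abs_self C
    have := le_abs_self C'
    split_ifs at h1 h2 ⊢ <;> first | linarith | grind

lemma IsWienerLimit.smul {X : Ω → EuclideanSpace ℝ (Fin d)} {φ : ℝ → ℝ} (r : ℝ)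
    (h : IsWienerLimit P W X φ) :
    IsWienerLimit P W (fun ω ↦ r • X ω) (fun u ↦ r * φ u) := by
  obtain ⟨c, hc, hφ, C, A, hb⟩ := h
  refine ⟨fun n ↦ r • c n, ?_, fun u ↦ ?_, |r| * C, A, fun n u ↦ ?_⟩
  · exact (tendstoInMeasure_const_smul r hc).congr_left fun n ↦
      ae_of_all _ fun ω ↦ by simp only [wienerSum_eq_linearCombination, map_smul]
  · simp_rw [stepFun_eq_linearCombination, map_smul]
    exact (hφ u).const_mul r
  · rw [show stepFun (r • c n) u = r * stepFun (c n) u by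
      simp only [stepFun_eq_linearCombination, map_smul, smul_eq_mul], abs_mul]
    refine (mul_le_mul_of_nonneg_left (hb n u) (abs_nonneg r)).trans (le_of_eq ?_)
    by_cases hu : u ∈ Ico 0 A <;> simp [hu]

lemma IsWienerLimit.sum {ι : Type*} (s : Finset ι) {X : ι → Ω → EuclideanSpace ℝ (Fin d)}
    {φ : ι → ℝ → ℝ} (h : ∀ i ∈ s, IsWienerLimit P W (X i) (φ i)) :
    IsWienerLimit P W (fun ω ↦ ∑ i ∈ s, X i ω) (fun u ↦ ∑ i ∈ s, φ i u) := by
  classical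
  induction s using Finset.induction_on with
  | empty => simpa using IsWienerLimit.zero
  | insert i s hi ih =>
    simp_rw [Finset.sum_insert hi]
    exact (h i (Finset.mem_insert_self i s)).add
      (ih fun j hj ↦ h j (Finset.mem_insert_of_mem hj))

/-- The defining Riemann sums are Wiener sums of the step functions `σ ∘ leftPoint` on `[0, t)`,
which converge by continuity of `σ` and are bounded by compactness. -/
lemma isWienerLimit_of_isWienerIntegral {σ : ℝ → ℝ} {t : ℝ≥0} (hσ : ContinuousOn σ (Icc 0 t))
    {X : Ω → EuclideanSpace ℝ (Fin d)} (h : IsWienerIntegral P W σ t X) :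
    IsWienerLimit P W X ((Ico (0 : ℝ) t).indicator σ) := by
  obtain ⟨C, hC⟩ := isCompact_Icc.exists_bound_of_continuousOn hσ
  -- For `t = 0` every increment vanishes; `leftPoint` would divide by zero.
  rcases eq_or_ne t 0 with rfl | ht0
  · refine ⟨fun _ ↦ 0, ?_, fun u ↦ by simp [stepFun], 0, 0, fun n u ↦ by simp [stepFun]⟩
    refine TendstoInMeasure.congr_left (fun n ↦ ae_of_all _ fun ω ↦ ?_) h
    simp [wienerSum]
  have ht : 0 < (t : ℝ) := by exact_mod_cast pos_iff_ne_zero.2 ht0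
  set c : ℕ → ℝ≥0 →₀ ℝ := fun n ↦ ∑ i ∈ Finset.range n, (σ (i * t / n)) •
    (Finsupp.single (((i : ℝ≥0) + 1) * t / n) (1 : ℝ) - Finsupp.single ((i : ℝ≥0) * t / n) (1 : ℝ))
    with hc
  have hwsum : ∀ n ω, wienerSum W (c n) ω = ∑ i ∈ Finset.range n, σ ((i : ℝ) * t / n) •
        (W (((i : ℝ≥0) + 1) * t / n) ω - W ((i : ℝ≥0) * t / n) ω) := fun n ω ↦ by
    simp only [wienerSum_eq_linearCombination, hc, map_sum, map_smul, map_sub,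
      Finsupp.linearCombination_single, one_smul]
  have hind : ∀ {v w u : ℝ}, 0 ≤ v → v ≤ w → (Ico 0 w).indicator (1 : ℝ → ℝ) u -
      (Ico 0 v).indicator (1 : ℝ → ℝ) u = (Ico v w).indicator (1 : ℝ → ℝ) u := fun hv hvw ↦ by
    simp only [indicator_apply, mem_Ico, Pi.one_apply]
    split_ifs <;> grind
  have hstep : ∀ n u, 0 < n → stepFun (c n) u =
      (Ico (0 : ℝ) t).indicator (fun u ↦ σ (leftPoint t (n : ℕ) u)) u := fun n u hn ↦ by
    have hn' : (0 : ℝ) < n := Nat.cast_pos.2 hn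
    have hsum : stepFun (c n) u = ∑ i ∈ Finset.range n, σ ((i : ℝ) * t / n) *
        (Ico ((i : ℝ) * t / n) (((i : ℝ) + 1) * t / n)).indicator 1 u := by
      simp only [stepFun_eq_linearCombination, hc, map_sum, map_smul, map_sub,
        Finsupp.linearCombination_single, smul_eq_mul, one_mul]
      refine Finset.sum_congr rfl fun i _ ↦ ?_
      push_cast
      rw [hind (by positivity) (by gcongr; exact le_add_of_nonneg_right zero_le_one)]
    rw [hsum]
    -- Exactly one partition interval contains `u`, the one with index `⌊u n / t⌋₊`.
    by_cases hu : u ∈ Ico (0 : ℝ) t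
    · have hj0 : 0 ≤ u * n / t := div_nonneg (mul_nonneg hu.1 hn'.le) ht.le
      have hj : u ∈ Ico ((⌊u * n / t⌋₊ : ℝ) * t / n) (((⌊u * n / t⌋₊ : ℝ) + 1) * t / n) := by
        constructor
        · rw [div_le_iff₀ hn', ← le_div_iff₀ ht]
          exact Nat.floor_le hj0
        · rw [lt_div_iff₀ hn', ← div_lt_iff₀ ht]
          exact Nat.lt_floor_add_one _
      have hjn : ⌊u * n / t⌋₊ < n := by
        rw [Nat.floor_lt hj0, div_lt_iff₀ ht, mul_comm]
        exact mul_lt_mul_of_pos_left hu.2 hn'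
      rw [indicator_of_mem hu, Finset.sum_eq_single ⌊u * n / t⌋₊, indicator_of_mem hj,
        leftPoint_eq ht hn hj, Pi.one_apply, mul_one]
      · intro i _ hi
        rw [indicator_of_notMem, mul_zero]
        intro hui
        have h1 := leftPoint_eq ht hn hui
        rw [leftPoint_eq ht hn hj] at h1
        field_simp at h1
        exact hi (by exact_mod_cast h1.symm)
      · exact fun h ↦ absurd (Finset.mem_range.2 hjn) h
    · rw [indicator_of_notMem hu]
      refine Finset.sum_eq_zero fun i hi ↦ ?_
      rw [indicator_of_notMem, mul_zero]
      refine fun hui ↦ hu ⟨le_trans (by positivity) hui.1, hui.2.trans_le ?_⟩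
      rw [div_le_iff₀ hn', mul_comm]
      have : (i : ℝ) + 1 ≤ n := by exact_mod_cast Finset.mem_range.1 hi
      gcongr
  have hmem : ∀ {n : ℕ}, 0 < n → ∀ {u}, u ∈ Ico 0 (t : ℝ) → leftPoint t n u ∈ Icc 0 (t : ℝ) :=
    fun hn u hu ↦ ⟨(leftPoint_mem ht hn hu.1).1, (leftPoint_mem ht hn hu.1).2.trans hu.2.le⟩
  refine ⟨c, ?_, fun u ↦ ?_, C, t, fun n u ↦ ?_⟩
  · exact TendstoInMeasure.congr_left (fun n ↦ ae_of_all _ fun ω ↦ (hwsum n ω).symm) h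
  · refine Tendsto.congr' (f₁ := fun n : ℕ ↦
      (Ico (0 : ℝ) t).indicator (fun u ↦ σ (leftPoint t n u)) u)
      (by filter_upwards [eventually_gt_atTop 0] with n hn using (hstep n u hn).symm) ?_
    by_cases hu : u ∈ Ico (0 : ℝ) t
    · simp only [indicator_of_mem hu]
      refine Tendsto.comp (hσ u ⟨hu.1, hu.2.le⟩)
        (tendsto_nhdsWithin_iff.2 ⟨tendsto_leftPoint ht hu.1, ?_⟩)
      filter_upwards [eventually_gt_atTop 0] with n hn using hmem hn hu
    · simp only [indicator_of_notMem hu]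
      exact tendsto_const_nhds
  · have hC0 : 0 ≤ C := (norm_nonneg _).trans (hC 0 ⟨le_rfl, ht.le⟩)
    rcases Nat.eq_zero_or_pos n with rfl | hn
    · simpa [hc, stepFun] using indicator_nonneg (fun _ _ ↦ hC0) u
    · rw [hstep n u hn]
      by_cases hu : u ∈ Ico (0 : ℝ) t
      · simp only [indicator_of_mem hu]
        exact hC _ (hmem hn hu)
      · simp [indicator_of_notMem hu]

end WienerLimit

/-! ### Deterministic identities for the noise schedule -/

section Schedule

open scoped Topology

variable {T : ℝ} {α β σ : ℝ → ℝ}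

lemma IsNoiseSchedule.contDiffOn_log (h : IsNoiseSchedule T α β) :
    ContDiffOn ℝ 1 (fun s ↦ Real.log (α s)) (Ico 0 T) :=
  h.alpha_contDiff.log fun s hs ↦ (h.alpha_pos s hs).ne'

lemma IsNoiseSchedule.continuousOn_drift (h : IsNoiseSchedule T α β) :
    ContinuousOn (drift T α) (Ico 0 T) :=
  h.contDiffOn_log.continuousOn_derivWithin (uniqueDiffOn_Ico 0 T) le_rfl

lemma IsNoiseSchedule.hasDerivWithinAt_alpha (h : IsNoiseSchedule T α β) {s : ℝ}
    (hs : s ∈ Ico 0 T) : HasDerivWithinAt α (α s * drift T α s) (Ico 0 T) s := by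
  have h1 : HasDerivWithinAt (fun s ↦ Real.log (α s)) (drift T α s) (Ico 0 T) s :=
    (h.contDiffOn_log.differentiableOn one_ne_zero s hs).hasDerivWithinAt
  have h2 := h1.exp
  rw [Real.exp_log (h.alpha_pos s hs)] at h2
  exact h2.congr (fun x hx ↦ (Real.exp_log (h.alpha_pos x hx)).symm)
    (Real.exp_log (h.alpha_pos s hs)).symm

lemma IsNoiseSchedule.hasDerivAt_alpha (h : IsNoiseSchedule T α β) {s : ℝ}
    (hs : s ∈ Ioo 0 T) : HasDerivAt α (α s * drift T α s) s :=
  (h.hasDerivWithinAt_alpha (Ioo_subset_Ico_self hs)).hasDerivAt (Ico_mem_nhds hs.1 hs.2)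

lemma IsNoiseSchedule.hasDerivAt_inv_alpha (h : IsNoiseSchedule T α β) {s : ℝ}
    (hs : s ∈ Ioo 0 T) : HasDerivAt (fun s ↦ (α s)⁻¹) (-(drift T α s / α s)) s := by
  have h0 := (h.alpha_pos s (Ioo_subset_Ico_self hs)).ne'
  refine ((h.hasDerivAt_alpha hs).fun_inv h0).congr_deriv ?_
  rw [pow_two, neg_div, mul_div_mul_left _ _ h0]

lemma IsNoiseSchedule.continuousOn_drift_div_alpha (h : IsNoiseSchedule T α β) :
    ContinuousOn (fun s ↦ drift T α s / α s) (Ico 0 T) :=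
  h.continuousOn_drift.div h.alpha_contDiff.continuousOn fun s hs ↦ (h.alpha_pos s hs).ne'

/-- `b/α` is the derivative of `-1/α`. This evaluates the weight that `dW_u` accumulates through the
drift after time `u`. -/
lemma IsNoiseSchedule.integral_drift_div_alpha (h : IsNoiseSchedule T α β) {u t : ℝ} (hu : 0 ≤ u)
    (hut : u ≤ t) (ht : t < T) :
    ∫ s in u..t, drift T α s / α s = (α u)⁻¹ - (α t)⁻¹ := by
  have hsub : Icc u t ⊆ Ico 0 T := fun s hs ↦ ⟨hu.trans hs.1, hs.2.trans_lt ht⟩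
  have hc := h.continuousOn_drift_div_alpha.mono hsub
  have hc' : ContinuousOn (fun s ↦ -(α s)⁻¹) (Icc u t) :=
    ((h.alpha_contDiff.continuousOn.mono hsub).inv₀ fun s hs ↦
      (h.alpha_pos s (hsub hs)).ne').neg
  rw [intervalIntegral.integral_eq_sub_of_hasDerivAt_of_le hut hc'
    (fun s hs ↦ by
      simpa using (h.hasDerivAt_inv_alpha ⟨hu.trans_lt hs.1, hs.2.trans ht⟩).fun_neg)
    (hc.intervalIntegrable_of_Icc hut)]
  ring

/-- The definition of `σ²` amounts to `(β²/α²)' = σ²/α²`; the boundary term at `0` vanishes since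
`β_0 = 0`. -/
lemma IsNoiseSchedule.integral_sq_mul_alpha_div (h : IsNoiseSchedule T α β)
    (hσc : ContinuousOn σ (Ico 0 T)) (hσ : ∀ t ∈ Ico 0 T, σ t ^ 2 = diffusionSq T α β t)
    {t : ℝ} (h0 : 0 ≤ t) (ht : t < T) :
    ∫ u in (0 : ℝ)..t, (σ u * (α t / α u)) ^ 2 = β t ^ 2 := by
  have hsub : Icc 0 t ⊆ Ico 0 T := fun s hs ↦ ⟨hs.1, hs.2.trans_lt ht⟩
  have hαc := h.alpha_contDiff.continuousOn.mono hsub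
  have hα0 : ∀ s ∈ Icc 0 t, α s ≠ 0 := fun s hs ↦ (h.alpha_pos s (hsub hs)).ne'
  have hαt := hα0 t ⟨h0, le_rfl⟩
  have hderiv : ∀ s ∈ Ioo 0 t, HasDerivAt (fun s ↦ α t ^ 2 * (β s ^ 2 * ((α s)⁻¹) ^ 2))
      ((σ s * (α t / α s)) ^ 2) s := fun s hs ↦ by
    have hs' : s ∈ Ioo 0 T := ⟨hs.1, hs.2.trans ht⟩
    have hsI := Ioo_subset_Ico_self hs'
    have hβ : HasDerivAt (fun s ↦ β s ^ 2) (derivWithin (fun s ↦ β s ^ 2) (Ico 0 T) s) s :=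
      (h.beta_sq_contDiff.differentiableOn one_ne_zero s hsI).hasDerivWithinAt.hasDerivAt
        (Ico_mem_nhds hs'.1 hs'.2)
    have hd := (hβ.fun_mul ((h.hasDerivAt_inv_alpha hs').fun_pow 2)).const_mul (α t ^ 2)
    have hsq := hσ s hsI
    rw [diffusionSq] at hsq
    refine hd.congr_deriv ?_
    rw [mul_pow, hsq]
    have hs0 : α s ≠ 0 := hα0 s (Ioo_subset_Icc_self hs)
    norm_num
    field_simp
    ring
  have hcont : ContinuousOn (fun s ↦ α t ^ 2 * (β s ^ 2 * ((α s)⁻¹) ^ 2)) (Icc 0 t) :=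
    continuousOn_const.mul
      ((h.beta_sq_contDiff.continuousOn.mono hsub).mul ((hαc.inv₀ hα0).pow 2))
  rw [intervalIntegral.integral_eq_sub_of_hasDerivAt_of_le h0 hcont hderiv
    ((((hσc.mono hsub).mul (continuousOn_const.div hαc hα0)).pow 2).intervalIntegrable_of_Icc h0),
    h.beta_zero]
  field_simp
  ring

/-- The variation of constants formula, in the form in which it recovers a solution of
`ζ' = b ζ + J'` from `J`. -/
lemma IsNoiseSchedule.variation_of_constants (h : IsNoiseSchedule T α β) {F : Type*}
    [NormedAddCommGroup F] [NormedSpace ℝ F] [CompleteSpace F] {ζ : ℝ → F}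
    (hζ : ContinuousOn ζ (Ico 0 T)) {t : ℝ} (h0 : 0 ≤ t) (ht : t < T) :
    ContinuousOn (fun s ↦ ζ s - ζ 0 - ∫ r in (0 : ℝ)..s, drift T α r • ζ r) (Icc 0 t) ∧
    (ζ t - ζ 0 - ∫ r in (0 : ℝ)..t, drift T α r • ζ r) +
      ∫ s in (0 : ℝ)..t, (α t * (drift T α s / α s)) •
        (ζ s - ζ 0 - ∫ r in (0 : ℝ)..s, drift T α r • ζ r) = ζ t - α t • ζ 0 := by
  have hsub : Icc 0 t ⊆ Ico 0 T := fun s hs ↦ ⟨hs.1, hs.2.trans_lt ht⟩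
  have hαc := h.alpha_contDiff.continuousOn.mono hsub
  have hα0 : ∀ s ∈ Icc 0 t, α s ≠ 0 := fun s hs ↦ (h.alpha_pos s (hsub hs)).ne'
  have hbζ : ContinuousOn (fun r ↦ drift T α r • ζ r) (Ico 0 T) := h.continuousOn_drift.smul hζ
  have hU : ContinuousOn (fun s ↦ ∫ r in (0 : ℝ)..s, drift T α r • ζ r) (Icc 0 t) := by
    have := intervalIntegral.continuousOn_primitive_interval (μ := volume) (a := 0) (b := t)
      (f := fun r ↦ drift T α r • ζ r)
      (by rw [uIcc_of_le h0]; exact (hbζ.mono hsub).integrableOn_Icc)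
    rwa [uIcc_of_le h0] at this
  have hJ : ContinuousOn (fun s ↦ ζ s - ζ 0 - ∫ r in (0 : ℝ)..s, drift T α r • ζ r) (Icc 0 t) :=
    ((hζ.mono hsub).sub continuousOn_const).sub hU
  refine ⟨hJ, ?_⟩
  -- The primitive involves `ζ` only through `∫ b ζ + ζ 0`, so the path `ζ`, merely continuous, is
  -- never differentiated.
  have hderiv : ∀ s ∈ Ioo 0 t, HasDerivAt
      (fun s ↦ (α s)⁻¹ • ((∫ r in (0 : ℝ)..s, drift T α r • ζ r) + ζ 0))
      ((drift T α s / α s) • (ζ s - ζ 0 - ∫ r in (0 : ℝ)..s, drift T α r • ζ r)) s := fun s hs ↦ by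
    have hs' : s ∈ Ioo 0 T := ⟨hs.1, hs.2.trans ht⟩
    have hnhds : Ico 0 T ∈ 𝓝 s := Ico_mem_nhds hs'.1 hs'.2
    have hUd : HasDerivAt (fun s ↦ ∫ r in (0 : ℝ)..s, drift T α r • ζ r) (drift T α s • ζ s) s :=
      intervalIntegral.integral_hasDerivAt_right
        ((hbζ.mono fun r hr ↦ ⟨hr.1, hr.2.trans_lt hs'.2⟩).intervalIntegrable_of_Icc hs.1.le)
        ((hbζ.mono Ioo_subset_Ico_self).stronglyMeasurableAtFilter isOpen_Ioo s hs')
        (hbζ.continuousAt hnhds)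
    refine ((h.hasDerivAt_inv_alpha hs').smul (hUd.add_const (ζ 0))).congr_deriv ?_
    rw [smul_smul, inv_mul_eq_div]
    module
  have hcont : ContinuousOn
      (fun s ↦ (α s)⁻¹ • ((∫ r in (0 : ℝ)..s, drift T α r • ζ r) + ζ 0)) (Icc 0 t) :=
    (hαc.inv₀ hα0).smul (hU.add continuousOn_const)
  have hint := intervalIntegral.integral_eq_sub_of_hasDerivAt_of_le h0 hcont hderiv
    (((h.continuousOn_drift_div_alpha.mono hsub).smul hJ).intervalIntegrable_of_Icc h0)
  simp_rw [mul_smul]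
  rw [intervalIntegral.integral_smul, hint, intervalIntegral.integral_same, h.alpha_zero, zero_add,
    inv_one, one_smul, smul_sub, smul_smul, mul_inv_cancel₀ (hα0 t ⟨h0, le_rfl⟩), one_smul]
  abel

lemma abs_sum_mul_le {t C : ℝ} (ht : 0 ≤ t) (hC : 0 ≤ C) {n : ℕ} {x : ℕ → ℝ}
    (hx : ∀ i ∈ Finset.range n, |x i| ≤ C) : |∑ i ∈ Finset.range n, t / n * x i| ≤ t * C := by
  rcases Nat.eq_zero_or_pos n with rfl | hn
  · simpa using mul_nonneg ht hC
  have hn' : (0 : ℝ) < n := Nat.cast_pos.2 hn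
  calc |∑ i ∈ Finset.range n, t / n * x i| ≤ ∑ i ∈ Finset.range n, |t / n * x i| :=
        Finset.abs_sum_le_sum_abs _ _
    _ ≤ ∑ i ∈ Finset.range n, t / n * C := Finset.sum_le_sum fun i hi ↦ by
        rw [abs_mul, abs_of_nonneg (by positivity)]
        have := hx i hi
        gcongr
    _ = t * C := by
        rw [Finset.sum_const, Finset.card_range, nsmul_eq_mul]
        field_simp

/-- The integrands of the Riemann approximations of the noise in the forward SDE. -/
lemma IsNoiseSchedule.tendsto_integrand (h : IsNoiseSchedule T α β) {t u : ℝ} (h0 : 0 < t)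
    (ht : t < T) (hu : u ∈ Ico 0 t) :
    Tendsto (fun n : ℕ ↦ ∑ i ∈ Finset.range n, t / n *
      (drift T α (i * t / n) / α (i * t / n) * (Ico (0 : ℝ) (i * t / n)).indicator 1 u)) atTop
      (𝓝 ((α u)⁻¹ - (α t)⁻¹)) := by
  have hsub : Icc 0 t ⊆ Ico 0 T := fun s hs ↦ ⟨hs.1, hs.2.trans_lt ht⟩
  have hc := h.continuousOn_drift_div_alpha
  obtain ⟨C, hC⟩ := isCompact_Icc.exists_bound_of_continuousOn (hc.mono hsub)
  -- As `u ≥ 0`, the condition `u ∈ [0, s)` is `s > u`. As a function of `s` the summand therefore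
  -- jumps only at `s = u`, a null set.
  set g : ℝ → ℝ := (Ioi u).indicator fun s ↦ drift T α s / α s with hg
  have hlim := tendsto_riemannSum (g := g) (C := C) h0
    (fun s hs ↦ (norm_indicator_le_norm_self _ _).trans (hC s (Ico_subset_Icc_self hs))) (by
      filter_upwards [compl_mem_ae_iff.2 (measure_singleton (μ := volume) u)] with s hsu hs
      rcases lt_or_gt_of_ne hsu with hlt | hgt
      · refine ContinuousAt.continuousWithinAt (continuousAt_const (y := (0 : ℝ)) |>.congr ?_)
        filter_upwards [Iio_mem_nhds hlt] with r hr
        exact (indicator_of_notMem (notMem_Ioi.2 (le_of_lt hr)) _).symm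
      · refine ((hc.mono hsub).mono Ico_subset_Icc_self s hs).congr_of_eventuallyEq ?_
          (indicator_of_mem hgt _)
        filter_upwards [mem_nhdsWithin_of_mem_nhds (Ioi_mem_nhds hgt)] with r hr
        exact indicator_of_mem hr _)
  have hval : ∫ s in (0 : ℝ)..t, g s = (α u)⁻¹ - (α t)⁻¹ := by
    rw [← h.integral_drift_div_alpha hu.1 hu.2.le ht, intervalIntegral.integral_of_le h0.le,
      intervalIntegral.integral_of_le hu.2.le, hg, setIntegral_indicator measurableSet_Ioi,
      Ioc_inter_Ioi, max_eq_right hu.1]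
  rw [hval] at hlim
  refine hlim.congr fun n ↦ Finset.sum_congr rfl fun i _ ↦ ?_
  rw [smul_eq_mul]
  congr 1
  by_cases hui : u < i * t / n
  · rw [hg, indicator_of_mem (mem_Ioi.2 hui),
      indicator_of_mem (show u ∈ Ico (0 : ℝ) (i * t / n) from ⟨hu.1, hui⟩), Pi.one_apply, mul_one]
  · rw [hg, indicator_of_notMem (by simpa using hui), indicator_of_notMem (fun h ↦ hui h.2),
      mul_zero]

end Schedule

/-! ### The transition law of the forward equation -/

section ForwardSDE

open scoped Topology

variable {Ω : Type*} [MeasurableSpace Ω] {P : Measure Ω} [IsProbabilityMeasure P] {d : ℕ}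
  {T : ℝ} {α β σ : ℝ → ℝ} {W Z : ℝ≥0 → Ω → EuclideanSpace ℝ (Fin d)}

/-- The transition law of the forward SDE: `Z_t - α_t Z_0` is centred Gaussian with covariance
`β_t² I`, independent of everything that is independent of `W`. -/
theorem SolvesLinearSDE.isIndepGaussian (hZ : SolvesLinearSDE P T (drift T α) σ W Z)
    (h : IsNoiseSchedule T α β) (hσc : ContinuousOn σ (Ico 0 T))
    (hσ : ∀ t ∈ Ico 0 T, σ t ^ 2 = diffusionSq T α β t) (hW : IsStdBrownian W P)
    {𝓨 : Type*} [MeasurableSpace 𝓨] {η : Ω → 𝓨} (hη : AEMeasurable η P)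
    (hind : IndepFun (fun ω (s : ℝ≥0) ↦ W s ω) η P) {t : ℝ≥0} (ht0 : 0 < t) (ht : (t : ℝ) < T) :
    IsIndepGaussian P η (fun ω ↦ Z t ω - α t • Z 0 ω) (β t ^ 2) := by
  have h0 : (0 : ℝ) < t := ht0
  have hsub : Icc 0 (t : ℝ) ⊆ Ico 0 T := fun s hs ↦ ⟨hs.1, hs.2.trans_lt ht⟩
  set I : ℝ≥0 → Ω → EuclideanSpace ℝ (Fin d) := fun s ω ↦
    Z s ω - Z 0 ω - ∫ r in (0 : ℝ)..(s : ℝ), drift T α r • Z r.toNNReal ω with hI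
  have hIW : ∀ s : ℝ≥0, (s : ℝ) < T → IsWienerLimit P W (I s) ((Ico (0 : ℝ) s).indicator σ) :=
    fun s hs ↦ isWienerLimit_of_isWienerIntegral
      (hσc.mono fun r hr ↦ ⟨hr.1, hr.2.trans_lt hs⟩) (hZ.integral_eq s hs)
  set κ : ℝ → ℝ := fun s ↦ drift T α s / α s with hκ
  have hpt : ∀ {n i : ℕ}, i ∈ Finset.range n → (i : ℝ) * t / n ∈ Icc 0 (t : ℝ) := fun {n i} hi ↦ by
    have hi' : (i : ℝ) ≤ n := by exact_mod_cast (Finset.mem_range.1 hi).le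
    have hn : (0 : ℝ) < n := by exact_mod_cast (Nat.zero_le i).trans_lt (Finset.mem_range.1 hi)
    refine ⟨by positivity, ?_⟩
    rw [div_le_iff₀ hn, mul_comm]
    gcongr
  -- Riemann approximation of `I_t + ∫₀ᵗ α_t κ(s) I_s ds`; `φ n` below is its integrand, found by
  -- linearity.
  set R : ℕ → Ω → EuclideanSpace ℝ (Fin d) := fun n ω ↦
    I t ω + ∑ i ∈ Finset.range n, (t / n : ℝ) • (α t * κ (i * t / n)) • I (i * t / n) ω with hR
  set φ : ℕ → ℝ → ℝ := fun n u ↦ (Ico (0 : ℝ) t).indicator σ u +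
    ∑ i ∈ Finset.range n, (t / n : ℝ) * ((α t * κ (i * t / n)) *
      (Ico (0 : ℝ) (i * t / n : ℝ≥0)).indicator σ u) with hφ
  have hRW : ∀ n, IsWienerLimit P W (R n) (φ n) := fun n ↦
    (hIW t ht).add (.sum _ fun i hi ↦
      ((hIW _ (by push_cast; exact (hsub (hpt hi)).2)).smul _).smul _)
  -- Along a continuous path the Riemann sums converge, and variation of constants identifies the
  -- limit; almost sure convergence implies convergence in measure.
  have hlim : TendstoInMeasure P R atTop (fun ω ↦ Z t ω - α t • Z 0 ω) := by
    refine tendstoInMeasure_of_tendsto_ae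
      (fun n ↦ ((hRW n).aemeasurable hW).aestronglyMeasurable) ?_
    filter_upwards [hZ.continuous_paths] with ω hω
    have hζ : ContinuousOn (fun s : ℝ ↦ Z s.toNNReal ω) (Ico 0 T) :=
      hω.comp continuous_real_toNNReal.continuousOn fun s hs ↦ by
        simpa [Real.coe_toNNReal s hs.1] using hs.2
    obtain ⟨hJ, hvar⟩ := h.variation_of_constants hζ h0.le ht
    have hg : ContinuousOn (fun s : ℝ ↦ (α t * (drift T α s / α s)) • (Z s.toNNReal ω -
        Z (Real.toNNReal 0) ω - ∫ r in (0 : ℝ)..s, drift T α r • Z r.toNNReal ω))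
        (Icc 0 (t : ℝ)) :=
      (continuousOn_const.mul (h.continuousOn_drift_div_alpha.mono hsub)).smul hJ
    obtain ⟨C, hC⟩ := isCompact_Icc.exists_bound_of_continuousOn hg
    have hsum := tendsto_riemannSum h0 (fun u hu ↦ hC u (Ico_subset_Icc_self hu))
      (ae_of_all _ fun u hu ↦ (hg u (Ico_subset_Icc_self hu)).mono Ico_subset_Icc_self)
    simp only [Real.toNNReal_coe, Real.toNNReal_zero] at hvar hsum
    rw [← hvar]
    refine (hsum.const_add (I t ω)).congr fun n ↦ ?_
    simp only [hR, hI]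
    congr 1
    refine Finset.sum_congr rfl fun i _ ↦ ?_
    have hcoe : (i : ℝ) * t / n = ((i * t / n : ℝ≥0) : ℝ) := by push_cast; rfl
    simp only [hcoe, Real.toNNReal_coe]
    rfl
  obtain ⟨Cσ, hCσ⟩ := isCompact_Icc.exists_bound_of_continuousOn (hσc.mono hsub)
  obtain ⟨Cκ, hCκ⟩ := isCompact_Icc.exists_bound_of_continuousOn
    (h.continuousOn_drift_div_alpha.mono hsub)
  have hCκ0 : 0 ≤ Cκ := (norm_nonneg _).trans (hCκ 0 ⟨le_rfl, h0.le⟩)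
  have hαt : 0 < α t := h.alpha_pos t ⟨h0.le, ht⟩
  have hφ_mem : ∀ n, ∀ u ∈ Ico (0 : ℝ) t, φ n u = σ u * (1 + α t * ∑ i ∈ Finset.range n,
      (t / n : ℝ) * (κ (i * t / n) * (Ico (0 : ℝ) (i * t / n)).indicator 1 u)) := fun n u hu ↦ by
    simp only [hφ, indicator_of_mem hu, mul_add, mul_one, Finset.mul_sum]
    congr 1
    refine Finset.sum_congr rfl fun i _ ↦ ?_
    push_cast
    by_cases hui : u ∈ Ico (0 : ℝ) (i * t / n)
    · simp only [indicator_of_mem hui, Pi.one_apply]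
      ring
    · simp only [indicator_of_notMem hui]
      ring
  have hφ_notMem : ∀ n, ∀ u ∉ Ico (0 : ℝ) t, φ n u = 0 := fun n u hu ↦ by
    simp only [hφ, indicator_of_notMem hu, zero_add]
    refine Finset.sum_eq_zero fun i hi ↦ ?_
    rw [indicator_of_notMem, mul_zero, mul_zero]
    push_cast
    exact fun hui ↦ hu ⟨hui.1, hui.2.trans_le (hpt hi).2⟩
  -- The limit integrand is `σ (1 + α_t (1/α_u - 1/α_t)) = σ α_t/α_u`; the constant bounds `σ` by
  -- `Cσ` and the Riemann sum by `t Cκ`.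
  have hint := tendsto_integral_sq_of_bounded (φ := φ)
    (φ' := (Ico (0 : ℝ) t).indicator fun u ↦ σ u * (α t / α u))
    (C := Cσ * (1 + α t * (t * Cκ))) (A := t) (fun n ↦ (hRW n).measurable) (fun u ↦ by
      by_cases hu : u ∈ Ico (0 : ℝ) t
      · simp only [hφ_mem _ u hu, indicator_of_mem hu]
        have hlim := (((h.tendsto_integrand h0 ht hu).const_mul (α t)).const_add 1).const_mul (σ u)
        convert hlim using 3
        field_simp
        ring
      · simp only [hφ_notMem _ u hu, indicator_of_notMem hu]
        exact tendsto_const_nhds) (fun n u ↦ by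
      by_cases hu : u ∈ Ico (0 : ℝ) t
      · rw [hφ_mem _ u hu, indicator_of_mem hu, abs_mul]
        have hs : |σ u| ≤ Cσ := hCσ u (Ico_subset_Icc_self hu)
        have hsum := abs_sum_mul_le h0.le hCκ0 (n := n)
          (x := fun i ↦ κ (i * t / n) * (Ico (0 : ℝ) (i * t / n)).indicator 1 u) fun i hi ↦ by
            rw [abs_mul]
            refine (mul_le_of_le_one_right (abs_nonneg _) ?_).trans (hCκ _ (hpt hi))
            by_cases hui : u ∈ Ico (0 : ℝ) (i * t / n) <;> simp [hui]
        refine mul_le_mul hs ?_ (abs_nonneg _) ((abs_nonneg _).trans hs)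
        refine (abs_add_le _ _).trans ?_
        rw [abs_one, abs_mul, abs_of_pos hαt]
        gcongr
      · rw [hφ_notMem _ u hu, indicator_of_notMem hu, abs_zero])
  have hval : ∫ u, (Ico (0 : ℝ) t).indicator (fun u ↦ σ u * (α t / α u)) u ^ 2 = β t ^ 2 := by
    rw [← h.integral_sq_mul_alpha_div hσc hσ h0.le ht, intervalIntegral.integral_of_le h0.le,
      ← integral_Ico_eq_integral_Ioc, ← integral_indicator measurableSet_Ico]
    congr 1
    ext1 u
    by_cases hu : u ∈ Ico (0 : ℝ) t <;> simp [hu]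
  rw [hval] at hint
  exact .of_tendstoInMeasure (fun n ↦ (hRW n).aemeasurable hW)
    (fun n ↦ (hRW n).isIndepGaussian hW hη hind) hlim hint

end ForwardSDE

end PosteriorScore

/-! ### The exact posterior score -/

theorem theorem1 {Ω : Type*} [MeasurableSpace Ω] (P : Measure Ω) [IsProbabilityMeasure P]
    {d r K : ℕ}
    -- the noise schedule and the coefficients of the forward SDE
    (T : ℝ) (α β σ : ℝ → ℝ) (hsched : PosteriorScore.IsNoiseSchedule T α β)
    (hσ_cont : ContinuousOn σ (Set.Ico 0 T))
    (hσ : ∀ t ∈ Set.Ico 0 T, σ t ^ 2 = PosteriorScore.diffusionSq T α β t)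
    -- the Gaussian mixture prior: weights, means and shared covariance
    (w : Fin K → ℝ) (hw : ∀ k, 0 ≤ w k) (hw_sum : ∑ k, w k = 1)
    (μ : Fin K → EuclideanSpace ℝ (Fin d)) (S : Matrix (Fin d) (Fin d) ℝ) (hS : S.PosDef)
    -- the observation operator and the observation noise covariance
    (M : EuclideanSpace ℝ (Fin d) → EuclideanSpace ℝ (Fin r)) (hM : Differentiable ℝ M)
    (Sobs : Matrix (Fin r) (Fin r) ℝ) (hSobs : Sobs.PosDef)
    -- the latent component, the forward process and the observation
    (ξ : Ω → Fin K) (W Z : ℝ≥0 → Ω → EuclideanSpace ℝ (Fin d))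
    (ε Y : Ω → EuclideanSpace ℝ (Fin r))
    (hprior : HasLaw (fun ω => (ξ ω, Z 0 ω))
      ((Measure.count.prod volume).withDensity
        (fun p => ENNReal.ofReal (w p.1 * PosteriorScore.gaussDensity (μ p.1) S p.2))) P)
    (hW : PosteriorScore.IsStdBrownian W P)
    (hε : HasLaw ε (multivariateGaussian 0 Sobs) P)
    (hind_ε : IndepFun ε (fun ω => (ξ ω, Z 0 ω)) P)
    (hind_W : IndepFun (fun ω (s : ℝ≥0) => W s ω) (fun ω => ((ξ ω, Z 0 ω), ε ω)) P)
    (hZ : PosteriorScore.SolvesLinearSDE P T (PosteriorScore.drift T α) σ W Z)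
    (hY : ∀ ω, Y ω = M (Z 0 ω) + ε ω)
    -- the diffusion time
    (t : ℝ≥0) (ht : 0 < t) (htT : (t : ℝ) < T)
    (f : Fin K → EuclideanSpace ℝ (Fin d) → EuclideanSpace ℝ (Fin d) →
      EuclideanSpace ℝ (Fin r) → ℝ)
    (hf : f = PosteriorScore.jointDensity w μ S (α t) (β t) M Sobs) :
    -- `f` is the joint density of `(ξ, Z_0, Z_t, Y)`
    HasLaw (fun ω => (ξ ω, Z 0 ω, Z t ω, Y ω))
      ((Measure.count.prod (volume.prod (volume.prod volume))).withDensity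
        (fun p => ENNReal.ofReal (f p.1 p.2.1 p.2.2.1 p.2.2.2))) P ∧
    -- the posterior density of `Z_t` given `Y = y` is positive
    (∀ z y, 0 < PosteriorScore.condDensityZt f z y) ∧
    -- the posterior score, wherever the conditional expectation in the formula exists
    (∀ z y,
      Integrable (fun z₀ => PosteriorScore.condDensityZ0 f z₀ z y •
        PosteriorScore.likelihoodScore M Sobs y z₀) →
      HasGradientAt (fun z' => Real.log (PosteriorScore.condDensityZt f z' y))
        (∑ k, PosteriorScore.posteriorWeight f k z y •
            PosteriorScore.componentScore S (α t) (β t) (μ k) z +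
          PosteriorScore.act (PosteriorScore.jacobianJ S (α t) (β t))
            (PosteriorScore.condExpectation f (PosteriorScore.likelihoodScore M Sobs y) z y))
        z) ∧
    -- `J(t)` is the Jacobian of the mean of the reverse-time transition kernel
    (∀ k z, HasFDerivAt (PosteriorScore.reverseMean S (α t) (β t) (μ k))
      (PosteriorScore.act (PosteriorScore.jacobianJ S (α t) (β t))) z) := by
  have htm : (t : ℝ) ∈ Set.Ioo 0 T := ⟨ht, htT⟩
  have hc : 0 < β t := hsched.beta_pos t htm
  have ha : 0 < α t := hsched.alpha_pos t (Ioo_subset_Ico_self htm)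
  have hη : AEMeasurable (fun ω ↦ ((ξ ω, Z 0 ω), ε ω)) P := hprior.aemeasurable.prodMk hε.aemeasurable
  have hincr : PosteriorScore.IsIndepGaussian P (fun ω ↦ ((ξ ω, Z 0 ω), ε ω))
      (fun ω ↦ Z t ω - α t • Z 0 ω) (β t ^ 2) :=
    hZ.isIndepGaussian hsched hσ_cont hσ hW hη hind_W ht htT
  have hincr_meas : AEMeasurable (fun ω ↦ Z t ω - α t • Z 0 ω) P :=
    (hZ.aemeasurable t htT).sub ((hZ.aemeasurable 0 (by simpa using hsched.T_pos)).const_smul (α t))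
  subst hf
  refine ⟨?_, PosteriorScore.condDensityZt_jointDensity_pos hS hc hM.continuous hSobs hw hw_sum,
    fun z y hint ↦ PosteriorScore.hasGradientAt_log_condDensityZt hS hc hM hSobs hw hw_sum z y hint,
    fun k z ↦ PosteriorScore.hasFDerivAt_reverseMean hS ha hc (μ k) z⟩
  -- Here `G = Z_t - α_t Z_0`, so `α_t Z_0 + G` is `Z_t`.
  have hlaw := PosteriorScore.hasLaw_jointDensity hw hS hM.continuous.measurable hSobs (a := α t) hc
    hprior hε (hincr.hasLaw hincr_meas) hind_ε (hincr.indepFun hη hincr_meas)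
  simpa only [add_sub_cancel, ← hY] using hlaw
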